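/- Let $\mathcal{D}(\mathbb{Z}_2)=\mathcal{Z}(\mathbb{Z}_2\text{-Vect})$ be the Drinfeld center of the category of finite-dimensional $\mathbb{Z}_2$-graded complex vector spaces. It is braided equivalent to the pointed braided category $\mathcal B$ with simple objects $m^ae^b$, $(a,b)\in\mathbb{Z}_2\times\mathbb{Z}_2$, with trivial associators and with braiding $c_{m^ae^b,m^{a'}e^{b'}}=(-1)^{ba'}$. Let $\mathbb{Z}_2=\{\pm1\}$ act trivially on $\mathbb{Z}_2\text{-Vect}\boxtimes\mathcal B$, the trivial $\mathbb{Z}_2$-crossed braided extension of $\mathcal B$ (graded by the first factor, with crossed braiding that of the second factor). For $p\in\{\pm1\}$ let $(\mathbb{Z}_2\text{-Vect}\boxtimes\mathcal B)^{(m,p)}$ be its $\mathbb{Z}_2$-crossed braided zesting with respect to $\lambda(-1,-1)=m$, $\lambda(g,h)=\mathbf 1$ otherwise, and $\nu(-1,-1,-1)=p$, $\nu(g,h,k)=1$ otherwise. Explicitly, for simple objects $X,Y,Z$ of degrees $|X|,|Y|,|Z|$: - $X\otimes^{(m,p)}Y=X\otimes Y\otimes\lambda(|X|,|Y|)$, with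 associator $\nu(|X|,|Y|,|Z|)\,c_{\lambda(|X|,|Y|),Z}$ and unchanged crossed braiding $c_{X,Y}\colon X\otimes Y\to Y\otimes \rho_{|Y|}(X)$; - $\mathbb{Z}_2$ acts by $\rho_g=\mathrm{id}$ on objects and morphisms, with $$(\rho_g^2)_{X,Y}=\frac{\nu(|X|,g,|Y|)}{\nu(|X|,|Y|,g)\,\nu(g,|X|,|Y|)}\colon\ \rho_g(X)\otimes\rho_g(Y)\to\rho_g(X\otimes Y),$$ $$(\rho^2_{g,h})_X=\frac{\nu(|X|,h,g)\,\nu(h,g,|X|)}{\nu(h,|X|,g)}\;c_{\lambda(h,g),X}\,c_{X,\lambda(h,g)}\colon\ \rho_g\rho_h(X)\to\rho_{hg}(X).$$ Let $\big((\mathbb{Z}_2\text{-Vect}\boxtimes\mathcal B)^{(m,p)}\big)^{\mathbb{Z}_2}$ be its $\mathbb{Z}_2$-equivariantisation, whose objects are objects $X$ with isomorphisms $u_g\colon\rho_g(X)\to X$ satisfying $u_g\circ\rho_g(u_h)=u_{hg}\circ(\rho^2_{g,h})_X$, whose tensor product is $(X,u)\otimes (Y,v)=(X\otimes Y,\,(u_g\otimes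 v_g)\circ(\rho^2_g)^{-1})$, and whose braiding is $\bigoplus_{h}(\mathrm{id}_{Y_h}\otimes u_h)\circ c_{X,Y_h}$, where $Y_h$ is the summand of $Y$ of degree $h$. For an abelian group $A$ and a normalised 3-cocycle $\omega$ on $A$ with values in $\mathbb{C}^\times$, let $A\text{-Vect}^{\omega}$ be the category of finite-dimensional $A$-graded vector spaces with associator $\omega$, and put $\mathcal{D}^{\omega}(A)=\mathcal{Z}(A\text{-Vect}^{\omega})$ and $\mathcal D(A)=\mathcal D^1(A)$. Then there are $\mathbb{C}$-linear braided monoidal equivalences $$\big((\mathbb{Z}_2\text{-Vect}\boxtimes\mathcal B)^{(m,1)}\big)^{\mathbb{Z}_2}\simeq\mathcal{D}(\mathbb{Z}_4),\qquad \big((\mathbb{Z}_2\text{-Vect}\boxtimes\mathcal B)^{(m,-1)}\big)^{\mathbb{Z}_2}\simeq\mathcal{D}^{\tilde p}(\mathbb{Z}_4),$$ where $\tilde p(k,l,n)=(-1)^{kln}$ for $k,l,n\in\mathbb{Z}_4$. Moreover, the second category is also braided equivalent to $(\mathbb{Z}_4\text{-Vect}^{\tilde p})^{\mathbb{Z}_4}$,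 the $\mathbb{Z}_4$-equivariantisation of the $\mathbb{Z}_4$-crossed braided category $\mathbb{Z}_4\text{-Vect}^{\tilde p}$, i.e. of the zesting of $\mathbb{Z}_4\text{-Vect}$ (graded by degree, trivial action and braiding) with $\lambda=\mathbf 1$, $\nu=\tilde p$ by the formulas above. -/

import Mathlib

open CategoryTheory MonoidalCategory TensorProduct

noncomputable section

namespace Gauging

/-- A normalised `3`-cocycle on `S` with values in `ℂˣ`. -/
structure ThreeCocycle (S : Type) [AddCommGroup S] where
  val : S → S → S → ℂˣ
  val_zero : ∀ x z, val x 0 z = 1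
  pentagon : ∀ x y z w,
    val x y z * val x (y + z) w * val y z w = val (x + y) z w * val x y (z + w)

/-- A pointed `G`-crossed braided category in skeletal form, for an abelian group `G` that acts
trivially on objects and morphisms. The simple objects form the abelian group `S`, all structure
morphisms on simple objects are scalars:
* `deg` is the grading;
* `assoc x y z` is the associator `(x ⊗ y) ⊗ z ⟶ x ⊗ (y ⊗ z)`;
* `tensorator g x y` is `(ρ²_g)_{x,y} : ρ_g(x) ⊗ ρ_g(y) ⟶ ρ_g(x ⊗ y)`;
* `compositor g h x` is `(ρ²_{g,h})_x : ρ_g(ρ_h(x)) ⟶ ρ_{hg}(x)`;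
* `braid x y` is the crossed braiding `x ⊗ y ⟶ y ⊗ ρ_{deg y}(x)`.
The remaining fields are the coherence axioms: every `ρ_g` is a monoidal functor, the compositors are
monoidal and associative, the crossed braiding is preserved by the action and satisfies the two
crossed hexagon identities. All units are strict. -/
structure CrossedData (G S : Type) [AddCommGroup G] [AddCommGroup S] where
  deg : S →+ G
  assoc : ThreeCocycle S
  tensorator : G → S → S → ℂˣ
  compositor : G → G → S → ℂˣ
  braid : S → S → ℂˣ
  tensorator_assoc : ∀ g x y z,
    tensorator g x y * tensorator g (x + y) z * assoc.val x y z =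
      assoc.val x y z * (tensorator g y z * tensorator g x (y + z))
  tensorator_zero_left : ∀ g y, tensorator g 0 y = 1
  tensorator_zero_right : ∀ g x, tensorator g x 0 = 1
  tensorator_id : ∀ x y, tensorator 0 x y = 1
  compositor_id_left : ∀ h x, compositor 0 h x = 1
  compositor_id_right : ∀ g x, compositor g 0 x = 1
  compositor_zero : ∀ g h, compositor g h 0 = 1
  compositor_assoc : ∀ f g h x,
    compositor g h x * compositor f (h + g) x = compositor f g x * compositor (g + f) h x
  compositor_tensor : ∀ g h x y,
    tensorator g x y * tensorator h x y * compositor g h (x + y) =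
      compositor g h x * compositor g h y * tensorator (h + g) x y
  braid_equivariant : ∀ g x y,
    tensorator g x y * compositor g (deg y) x = tensorator g y x * compositor (deg y) g x
  hexagon_forward : ∀ x y z,
    assoc.val x y z * braid x (y + z) * assoc.val y z x =
      braid x y * assoc.val y x z * braid x z * compositor (deg z) (deg y) x
  hexagon_reverse : ∀ x y z,
    (assoc.val x y z)⁻¹ * (braid (x + y) z * (tensorator (deg z) x y)⁻¹) * (assoc.val z x y)⁻¹ =
      braid y z * (assoc.val x z y)⁻¹ * braid x z

/-- A pointed `G`-crossed braided category whose associators, tensorators and compositors are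
identities: the simple objects form the abelian group `S`, which is graded by `deg`, and the
braiding is a bicharacter. -/
structure StrictCrossed (G S : Type) [AddCommGroup G] [AddCommGroup S] where
  deg : S →+ G
  braid : S → S → ℂˣ
  braid_add_left : ∀ x y z, braid (x + y) z = braid x z * braid y z
  braid_add_right : ∀ x y z, braid x (y + z) = braid x y * braid x z

/-- A zesting datum: the fractionalisation is a `2`-cocycle `frac` (usually called `λ`) with values in
the simple objects of degree `0`, the defectification is a `3`-cochain `assoc` (usually called `ν`, or
`p`) that solves the pentagon equation of the zesting; there the crossing of the strands `λ(g, h)` and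
`λ(k, l)` contributes a braiding. The cochain `frac` is symmetric, so that the zested action of `G`
is still trivial on objects. -/
structure ZestingDatum {G S : Type} [AddCommGroup G] [AddCommGroup S]
    (C : StrictCrossed G S) where
  frac : G → G → S
  deg_frac : ∀ g h, C.deg (frac g h) = 0
  frac_zero : ∀ g, frac 0 g = 0
  frac_comm : ∀ g h, frac g h = frac h g
  frac_cocycle : ∀ g h k, frac g h + frac (g + h) k = frac h k + frac g (h + k)
  assoc : G → G → G → ℂˣ
  assoc_zero : ∀ g k, assoc g 0 k = 1
  assoc_pentagon : ∀ g h k l,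
    assoc g h k * assoc g (h + k) l * assoc h k l =
      assoc (g + h) k l * assoc g h (k + l) * C.braid (frac g h) (frac k l)

section Zest
variable {G S : Type} [AddCommGroup G] [AddCommGroup S] {C : StrictCrossed G S}

/-- The simple objects of the zesting: those of the original category, with the new tensor product
`x ⊗ y ⊗ λ(deg x, deg y)`. -/
def Zested (_Z : ZestingDatum C) : Type := S

namespace Zested
variable (Z : ZestingDatum C)

instance [Fintype S] : Fintype (Zested Z) := inferInstanceAs (Fintype S)
instance [DecidableEq S] : DecidableEq (Zested Z) := inferInstanceAs (DecidableEq S)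

/-- The simple object of the zesting with the same underlying simple object. -/
def of (x : S) : Zested Z := x
/-- The underlying simple object of the original category. -/
def un (x : Zested Z) : S := x

instance : Add (Zested Z) := ⟨fun x y =>
  of Z (un Z x + un Z y + Z.frac (C.deg (un Z x)) (C.deg (un Z y)))⟩
instance : Zero (Zested Z) := ⟨of Z 0⟩
instance : Neg (Zested Z) := ⟨fun x =>
  of Z (-un Z x - Z.frac (C.deg (un Z x)) (-C.deg (un Z x)))⟩

theorem un_add (x y : Zested Z) :
    un Z (x + y) = un Z x + un Z y + Z.frac (C.deg (un Z x)) (C.deg (un Z y)) := rfl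
theorem un_zero : un Z 0 = 0 := rfl
theorem un_neg (x : Zested Z) :
    un Z (-x) = -un Z x - Z.frac (C.deg (un Z x)) (-C.deg (un Z x)) := rfl
theorem un_inj {x y : Zested Z} (h : un Z x = un Z y) : x = y := h

instance : AddCommGroup (Zested Z) where
  add_assoc x y z := un_inj Z <| by
    have h := Z.frac_cocycle (C.deg (un Z x)) (C.deg (un Z y)) (C.deg (un Z z))
    simp only [un_add, map_add, Z.deg_frac, add_zero]
    rw [← sub_eq_zero] at h ⊢
    rw [← h]; abel
  zero_add x := un_inj Z <| by simp [un_add, un_zero, Z.frac_zero]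
  add_zero x := un_inj Z <| by simp [un_add, un_zero, Z.frac_zero, Z.frac_comm _ 0]
  neg_add_cancel x := un_inj Z <| by
    simp only [un_add, un_zero, un_neg, Z.deg_frac, map_sub, map_neg, sub_zero,
      Z.frac_comm (-C.deg (un Z x))]
    abel
  add_comm x y := un_inj Z <| by
    simp only [un_add]; rw [Z.frac_comm, add_comm (un Z x)]
  nsmul := nsmulRec
  zsmul := zsmulRec

/-- The grading of the zesting, which agrees with the original grading. -/
def degHom : Zested Z →+ G where
  toFun x := C.deg (un Z x)
  map_zero' := map_zero C.deg
  map_add' x y := by simp [un_add, Z.deg_frac]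

theorem degHom_apply (x : Zested Z) : degHom Z x = C.deg (un Z x) := rfl

end Zested

namespace ZestingDatum
variable (Z : ZestingDatum C)

theorem braid_zero_left (C : StrictCrossed G S) (x : S) : C.braid 0 x = 1 := by
  have h := C.braid_add_left 0 0 x
  simpa using h
theorem braid_zero_right (C : StrictCrossed G S) (x : S) : C.braid x 0 = 1 := by
  have h := C.braid_add_right x 0 0
  simpa using h

theorem frac_zero' (g : G) : Z.frac g 0 = 0 := by rw [Z.frac_comm, Z.frac_zero]

theorem assoc_zero_left (h k : G) : Z.assoc 0 h k = 1 := by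
  have h1 := Z.assoc_pentagon 0 0 h k
  have h2 := Z.assoc_pentagon 0 0 0 h
  simp only [Z.frac_zero, braid_zero_left, add_zero, zero_add, Z.assoc_zero, mul_one,
    one_mul] at h1 h2
  simpa using h1
theorem assoc_zero_right (g h : G) : Z.assoc g h 0 = 1 := by
  have h1 := Z.assoc_pentagon g h 0 0
  simp only [Z.frac_zero, braid_zero_right, add_zero, Z.assoc_zero, mul_one] at h1
  simpa using h1

section
variable {M : Type} [AddCommGroup M] (N : G → G → G → M) (b : G → G → G → G → M)

theorem aux_tensorator
    (hZ : ∀ g h k l,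
      N g h k + N g (h + k) l + N h k l = N (g + h) k l + N g h (k + l) + b g h k l)
    (hb₁ : ∀ g h k l, b g h k l = b h g k l) (hb₂ : ∀ g h k l, b g h k l = b g h l k)
    (g x y z : G) :
    (N x g y - N x y g - N g x y) + (N (x + y) g z - N (x + y) z g - N g (x + y) z) =
    (N y g z - N y z g - N g y z) + (N x g (y + z) - N x (y + z) g - N g x (y + z)) := by
  have h1 := hZ g x y z
  have h2 := hZ x g y z
  have h3 := hZ x y g z
  have h4 := hZ x y z g
  have e1 := hb₁ g x y z
  have e2 := hb₂ x y g z
  rw [add_comm g x] at *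
  rw [add_comm g y] at *
  rw [add_comm g z] at *
  grind

theorem aux_compositor_tensor
    (hZ : ∀ g h k l,
      N g h k + N g (h + k) l + N h k l = N (g + h) k l + N g h (k + l) + b g h k l)
    (hb₁ : ∀ g h k l, b g h k l = b h g k l) (hb₂ : ∀ g h k l, b g h k l = b g h l k)
    (g h x y : G) :
    (N x g y - N x y g - N g x y) + (N x h y - N x y h - N h x y) +
      (N (x + y) h g + N h g (x + y) - N h (x + y) g) + b x y h g + b h g x y =
    (N x h g + N h g x - N h x g) + (N y h g + N h g y - N h y g) +
      (N x (h + g) y - N x y (h + g) - N (h + g) x y) := by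
  have h1 := hZ x y h g
  have h2 := hZ x h y g
  have h3 := hZ h x y g
  have h4 := hZ x h g y
  have h5 := hZ h x g y
  have h6 := hZ h g x y
  have e1 := hb₁ x h y g
  have e2 := hb₂ x h y g
  have e3 := hb₂ h x y g
  rw [add_comm h x] at *
  rw [add_comm g x] at *
  rw [add_comm g y] at *
  rw [add_comm h y] at *
  grind

theorem aux_compositor_assoc
    (hZ : ∀ g h k l,
      N g h k + N g (h + k) l + N h k l = N (g + h) k l + N g h (k + l) + b g h k l)
    (hb₁ : ∀ g h k l, b g h k l = b h g k l) (hb₂ : ∀ g h k l, b g h k l = b g h l k)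
    (f g h x : G) :
    (N x h g + N h g x - N h x g) + (N x (h + g) f + N (h + g) f x - N (h + g) x f) =
    (N x g f + N g f x - N g x f) + (N x h (g + f) + N h (g + f) x - N h x (g + f)) := by
  have h1 := hZ x h g f
  have h2 := hZ h x g f
  have h3 := hZ h g x f
  have h4 := hZ h g f x
  have e1 := hb₁ x h g f
  have e2 := hb₂ h g x f
  rw [add_comm h x] at *
  rw [add_comm g x] at *
  rw [add_comm f x] at *
  grind
end

theorem ofMul_pentagon (g h k l : G) :
    Additive.ofMul (Z.assoc g h k) + Additive.ofMul (Z.assoc g (h + k) l) +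
        Additive.ofMul (Z.assoc h k l) =
      Additive.ofMul (Z.assoc (g + h) k l) + Additive.ofMul (Z.assoc g h (k + l)) +
        Additive.ofMul (C.braid (Z.frac g h) (Z.frac k l)) :=
  congrArg Additive.ofMul (Z.assoc_pentagon g h k l)

end ZestingDatum

open Zested ZestingDatum in
/-- The zesting of `C`. On simple objects `x`, `y`, `z` of degrees `i`, `j`, `k`:
* the associator is `ν(i, j, k)` times the braiding of `λ(i, j)` with `z`;
* the tensorator of `ρ_g` is `ν(i, j, g)⁻¹ ν(i, g, j) ν(g, i, j)⁻¹`;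
* the compositor of `ρ_g` and `ρ_h` is `ν(i, h, g) ν(h, i, g)⁻¹ ν(h, g, i)` times the double braiding
  of `λ(h, g)` with `x`;
* the crossed braiding is the original one. -/
def zest (C : StrictCrossed G S) (Z : ZestingDatum C) : CrossedData G (Zested Z) where
  deg := degHom Z
  assoc :=
    { val := fun x y z =>
        Z.assoc (C.deg (un Z x)) (C.deg (un Z y)) (C.deg (un Z z)) *
          C.braid (Z.frac (C.deg (un Z x)) (C.deg (un Z y))) (un Z z)
      val_zero := fun x z => by
        simp [un_zero, Z.assoc_zero, frac_zero', braid_zero_left]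
      pentagon := fun x y z w => by
        have h1 := Z.ofMul_pentagon (C.deg (un Z x)) (C.deg (un Z y)) (C.deg (un Z z))
          (C.deg (un Z w))
        have h2 := congrArg (fun t => Additive.ofMul (C.braid t (un Z w)))
          (Z.frac_cocycle (C.deg (un Z x)) (C.deg (un Z y)) (C.deg (un Z z)))
        apply Additive.ofMul.injective
        simp only [un_add, map_add, Z.deg_frac, add_zero, C.braid_add_left, C.braid_add_right,
          ofMul_mul] at h1 h2 ⊢
        grind }
  tensorator := fun g x y =>
    (Z.assoc (C.deg (un Z x)) (C.deg (un Z y)) g)⁻¹ *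
      Z.assoc (C.deg (un Z x)) g (C.deg (un Z y)) *
      (Z.assoc g (C.deg (un Z x)) (C.deg (un Z y)))⁻¹
  compositor := fun g h x =>
    Z.assoc (C.deg (un Z x)) h g * (Z.assoc h (C.deg (un Z x)) g)⁻¹ *
      Z.assoc h g (C.deg (un Z x)) *
      (C.braid (Z.frac h g) (un Z x) * C.braid (un Z x) (Z.frac h g))
  braid := fun x y => C.braid (un Z x) (un Z y)
  tensorator_assoc := fun g x y z => by
    have h := aux_tensorator _ _ Z.ofMul_pentagon
      (fun g h k l => by rw [Z.frac_comm g h]) (fun g h k l => by rw [Z.frac_comm k l])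
      g (C.deg (un Z x)) (C.deg (un Z y)) (C.deg (un Z z))
    apply Additive.ofMul.injective
    simp only [un_add, map_add, Z.deg_frac, add_zero, ofMul_mul, ofMul_inv] at h ⊢
    grind
  tensorator_zero_left := fun g y => by
    simp [un_zero, Z.assoc_zero, assoc_zero_left]
  tensorator_zero_right := fun g y => by
    simp [un_zero, Z.assoc_zero, assoc_zero_right]
  tensorator_id := fun x y => by
    simp [Z.assoc_zero, assoc_zero_right, assoc_zero_left]
  compositor_id_left := fun h x => by
    simp [Z.assoc_zero, assoc_zero_right, frac_zero', braid_zero_left, braid_zero_right]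
  compositor_id_right := fun h x => by
    simp [Z.assoc_zero, assoc_zero_left, Z.frac_zero, braid_zero_left, braid_zero_right]
  compositor_zero := fun g h => by
    simp [un_zero, Z.assoc_zero, assoc_zero_left, assoc_zero_right, braid_zero_left,
      braid_zero_right]
  compositor_assoc := fun f g h x => by
    have h1 := aux_compositor_assoc _ _ Z.ofMul_pentagon
      (fun g h k l => by rw [Z.frac_comm g h]) (fun g h k l => by rw [Z.frac_comm k l])
      f g h (C.deg (un Z x))
    have h2 := congrArg (fun t => Additive.ofMul (C.braid t (un Z x))) (Z.frac_cocycle h g f)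
    have h3 := congrArg (fun t => Additive.ofMul (C.braid (un Z x) t)) (Z.frac_cocycle h g f)
    apply Additive.ofMul.injective
    simp only [C.braid_add_left, C.braid_add_right, ofMul_mul, ofMul_inv] at h1 h2 h3 ⊢
    grind
  compositor_tensor := fun g h x y => by
    have h1 := aux_compositor_tensor _ _ Z.ofMul_pentagon
      (fun g h k l => by rw [Z.frac_comm g h]) (fun g h k l => by rw [Z.frac_comm k l])
      g h (C.deg (un Z x)) (C.deg (un Z y))
    apply Additive.ofMul.injective
    simp only [un_add, map_add, Z.deg_frac, add_zero, C.braid_add_left, C.braid_add_right,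
      ofMul_mul, ofMul_inv] at h1 ⊢
    grind
  braid_equivariant := fun g x y => by
    apply Additive.ofMul.injective
    have h1 := Z.frac_comm g (C.deg (un Z y))
    simp only [degHom_apply, ofMul_mul, ofMul_inv, h1]
    grind
  hexagon_forward := fun x y z => by
    apply Additive.ofMul.injective
    have h1 := Z.frac_comm (C.deg (un Z x)) (C.deg (un Z y))
    simp only [degHom_apply, un_add, C.braid_add_right, ofMul_mul, ofMul_inv, h1]
    grind
  hexagon_reverse := fun x y z => by
    apply Additive.ofMul.injective
    have h1 := Z.frac_comm (C.deg (un Z x)) (C.deg (un Z z))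
    simp only [degHom_apply, un_add, C.braid_add_left, ofMul_mul, ofMul_inv, h1]
    grind

end Zest

/-- A finite-dimensional `S`-graded complex vector space: `proj x` is the projection to the component
of degree `x`. The cocycle `ω` only enters the associator of the tensor product. -/
structure GVec {S : Type} [AddCommGroup S] [Fintype S] [DecidableEq S]
    (ω : ThreeCocycle S) where
  carrier : Type
  [addCommGroup : AddCommGroup carrier]
  [module : Module ℂ carrier]
  [finite : Module.Finite ℂ carrier]
  proj : S → carrier →ₗ[ℂ] carrier
  proj_proj : ∀ x y v, proj x (proj y v) = if x = y then proj y v else 0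
  sum_proj : ∀ v, ∑ x, proj x v = v

attribute [instance] GVec.addCommGroup GVec.module GVec.finite

namespace GVec
variable {S : Type} [AddCommGroup S] [Fintype S] [DecidableEq S] {ω : ThreeCocycle S}

/-- Morphisms of graded vector spaces: the linear maps that preserve the grading. -/
def homs (X Y : GVec ω) : Submodule ℂ (X.carrier →ₗ[ℂ] Y.carrier) where
  carrier := {f | ∀ x v, f (X.proj x v) = Y.proj x (f v)}
  zero_mem' := fun x v => by simp
  add_mem' := fun {f g} hf hg x v => by simp [hf x v, hg x v]
  smul_mem' := fun c f hf x v => by simp [hf x v]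

instance : Category (GVec ω) where
  Hom X Y := homs X Y
  id X := ⟨LinearMap.id, fun _ _ => rfl⟩
  comp f g := ⟨g.1 ∘ₗ f.1, fun x v => by
    rw [LinearMap.comp_apply, f.2, g.2, LinearMap.comp_apply]⟩

instance (X Y : GVec ω) : AddCommGroup (X ⟶ Y) := inferInstanceAs (AddCommGroup (homs X Y))
instance (X Y : GVec ω) : Module ℂ (X ⟶ Y) := inferInstanceAs (Module ℂ (homs X Y))

/-- The linear map underlying a morphism. -/
def lin {X Y : GVec ω} (f : X ⟶ Y) : X.carrier →ₗ[ℂ] Y.carrier := Subtype.val f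

/-- The morphism given by a linear map that preserves the grading. -/
def ofLin {X Y : GVec ω} (f : X.carrier →ₗ[ℂ] Y.carrier)
    (h : ∀ x v, f (X.proj x v) = Y.proj x (f v)) : X ⟶ Y := ⟨f, h⟩

@[simp] theorem lin_ofLin {X Y : GVec ω} (f : X.carrier →ₗ[ℂ] Y.carrier)
    (h : ∀ x v, f (X.proj x v) = Y.proj x (f v)) : lin (ofLin f h) = f := rfl

theorem lin_proj {X Y : GVec ω} (f : X ⟶ Y) (x : S) (v : X.carrier) :
    lin f (X.proj x v) = Y.proj x (lin f v) := f.2 x v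

@[simp] theorem lin_id (X : GVec ω) : lin (𝟙 X) = LinearMap.id := rfl
@[simp] theorem lin_comp {X Y Z : GVec ω} (f : X ⟶ Y) (g : Y ⟶ Z) :
    lin (f ≫ g) = lin g ∘ₗ lin f := rfl
@[simp] theorem lin_add {X Y : GVec ω} (f g : X ⟶ Y) : lin (f + g) = lin f + lin g := rfl
@[simp] theorem lin_zero {X Y : GVec ω} : lin (0 : X ⟶ Y) = 0 := rfl
@[simp] theorem lin_smul {X Y : GVec ω} (c : ℂ) (f : X ⟶ Y) : lin (c • f) = c • lin f := rfl

@[ext] theorem hom_ext {X Y : GVec ω} {f g : X ⟶ Y} (h : lin f = lin g) : f = g :=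
  Subtype.ext h

theorem lin_sum {X Y : GVec ω} {ι : Type} (s : Finset ι) (f : ι → (X ⟶ Y)) :
    lin (∑ i ∈ s, f i) = ∑ i ∈ s, lin (f i) :=
  map_sum (homs X Y).subtype f s

instance : Preadditive (GVec ω) where
  add_comp X Y Z f g h := by ext v; simp
  comp_add X Y Z f g h := by ext v; simp

instance : Linear ℂ (GVec ω) where
  smul_comp X Y Z c f g := by ext v; simp
  comp_smul X Y Z f c g := by ext v; simp

/-- `v` is homogeneous of degree `x`. -/
def IsHomog (X : GVec ω) (x : S) (v : X.carrier) : Prop := X.proj x v = v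

theorem isHomog_proj (X : GVec ω) (x : S) (v : X.carrier) : X.IsHomog x (X.proj x v) := by
  simp [IsHomog, X.proj_proj]

theorem IsHomog.proj {X : GVec ω} {x : S} {v : X.carrier} (hv : X.IsHomog x v) (y : S) :
    X.proj y v = if y = x then v else 0 := by
  have h := X.proj_proj y x v
  rwa [hv] at h

theorem IsHomog.map {X Y : GVec ω} (f : X ⟶ Y) {x : S} {v : X.carrier} (hv : X.IsHomog x v) :
    Y.IsHomog x (lin f v) := by
  rw [IsHomog, ← lin_proj, hv]

theorem lin_ext {X : GVec ω} {M : Type*} [AddCommGroup M] [Module ℂ M]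
    {f g : X.carrier →ₗ[ℂ] M} (h : ∀ x v, X.IsHomog x v → f v = g v) : f = g := by
  ext v
  rw [← X.sum_proj v, map_sum, map_sum]
  exact Finset.sum_congr rfl fun x _ => h x _ (X.isHomog_proj x v)

theorem lin_ext₂ {X Y : GVec ω} {M : Type*} [AddCommGroup M] [Module ℂ M]
    {f g : X.carrier ⊗[ℂ] Y.carrier →ₗ[ℂ] M}
    (h : ∀ x v, X.IsHomog x v → ∀ y w, Y.IsHomog y w → f (v ⊗ₜ w) = g (v ⊗ₜ w)) : f = g := by
  refine TensorProduct.ext (lin_ext fun x v hv => lin_ext fun y w hw => ?_)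
  exact h x v hv y w hw

theorem lin_ext₃ {X Y Z : GVec ω} {M : Type*} [AddCommGroup M] [Module ℂ M]
    {f g : (X.carrier ⊗[ℂ] Y.carrier) ⊗[ℂ] Z.carrier →ₗ[ℂ] M}
    (h : ∀ x v, X.IsHomog x v → ∀ y w, Y.IsHomog y w → ∀ z t, Z.IsHomog z t →
      f ((v ⊗ₜ w) ⊗ₜ t) = g ((v ⊗ₜ w) ⊗ₜ t)) : f = g := by
  refine TensorProduct.ext (lin_ext₂ fun x v hv y w hw => lin_ext fun z t ht => ?_)
  exact h x v hv y w hw z t ht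

theorem lin_ext₃' {X Y Z : GVec ω} {M : Type*} [AddCommGroup M] [Module ℂ M]
    {f g : X.carrier ⊗[ℂ] (Y.carrier ⊗[ℂ] Z.carrier) →ₗ[ℂ] M}
    (h : ∀ x v, X.IsHomog x v → ∀ y w, Y.IsHomog y w → ∀ z t, Z.IsHomog z t →
      f (v ⊗ₜ (w ⊗ₜ t)) = g (v ⊗ₜ (w ⊗ₜ t))) : f = g := by
  refine TensorProduct.ext (lin_ext fun x v hv => lin_ext₂ fun y w hw z t ht => ?_)
  exact h x v hv y w hw z t ht

theorem lin_ext₄ {X Y Z W : GVec ω} {M : Type*} [AddCommGroup M] [Module ℂ M]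
    {f g : ((X.carrier ⊗[ℂ] Y.carrier) ⊗[ℂ] Z.carrier) ⊗[ℂ] W.carrier →ₗ[ℂ] M}
    (h : ∀ x v, X.IsHomog x v → ∀ y w, Y.IsHomog y w → ∀ z t, Z.IsHomog z t →
      ∀ a s, W.IsHomog a s →
      f (((v ⊗ₜ w) ⊗ₜ t) ⊗ₜ s) = g (((v ⊗ₜ w) ⊗ₜ t) ⊗ₜ s)) : f = g := by
  refine TensorProduct.ext (lin_ext₃ fun x v hv y w hw z t ht => lin_ext fun a s hs => ?_)
  exact h x v hv y w hw z t ht a s hs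

/-! ### Linear maps that are scalar on homogeneous vectors -/

/-- The operator multiplying the component of degree `x` by `f x`. -/
def scalar₁ (X : GVec ω) (f : S → ℂ) : X.carrier →ₗ[ℂ] X.carrier := ∑ x, f x • X.proj x

/-- The operator multiplying the component of bidegree `(x, y)` by `f x y`. -/
def scalar₂ (X Y : GVec ω) (f : S → S → ℂ) :
    X.carrier ⊗[ℂ] Y.carrier →ₗ[ℂ] X.carrier ⊗[ℂ] Y.carrier :=
  ∑ x, ∑ y, f x y • TensorProduct.map (X.proj x) (Y.proj y)

/-- The operator multiplying the component of tridegree `(x, y, z)` by `f x y z`. -/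
def scalar₃ (X Y Z : GVec ω) (f : S → S → S → ℂ) :
    (X.carrier ⊗[ℂ] Y.carrier) ⊗[ℂ] Z.carrier →ₗ[ℂ]
      (X.carrier ⊗[ℂ] Y.carrier) ⊗[ℂ] Z.carrier :=
  ∑ x, ∑ y, ∑ z,
    f x y z • TensorProduct.map (TensorProduct.map (X.proj x) (Y.proj y)) (Z.proj z)

theorem scalar₁_apply (X : GVec ω) (f : S → ℂ) {x : S} {v : X.carrier}
    (hv : X.IsHomog x v) : scalar₁ X f v = f x • v := by
  simp [scalar₁, hv.proj]

theorem scalar₂_apply (X Y : GVec ω) (f : S → S → ℂ) {x y : S} {v : X.carrier} {w : Y.carrier}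
    (hv : X.IsHomog x v) (hw : Y.IsHomog y w) :
    scalar₂ X Y f (v ⊗ₜ w) = f x y • (v ⊗ₜ w) := by
  simp only [scalar₂, LinearMap.sum_apply, LinearMap.smul_apply, TensorProduct.map_tmul,
    hv.proj, hw.proj]
  rw [Finset.sum_eq_single x, Finset.sum_eq_single y] <;> simp +contextual

theorem scalar₃_apply (X Y Z : GVec ω) (f : S → S → S → ℂ) {x y z : S} {v : X.carrier}
    {w : Y.carrier} {t : Z.carrier} (hv : X.IsHomog x v) (hw : Y.IsHomog y w)
    (ht : Z.IsHomog z t) :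
    scalar₃ X Y Z f ((v ⊗ₜ w) ⊗ₜ t) = f x y z • ((v ⊗ₜ w) ⊗ₜ t) := by
  simp only [scalar₃, LinearMap.sum_apply, LinearMap.smul_apply, TensorProduct.map_tmul,
    hv.proj, hw.proj, ht.proj]
  rw [Finset.sum_eq_single x, Finset.sum_eq_single y, Finset.sum_eq_single z] <;>
    simp +contextual

/-- The automorphism multiplying the component of degree `x` by `f x`. -/
def scalarIso (X : GVec ω) (f : S → ℂˣ) : X ≅ X where
  hom := ofLin (scalar₁ X fun x => f x) fun y v => by
    simp [scalar₁, X.proj_proj, map_sum, Finset.sum_ite_eq]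
  inv := ofLin (scalar₁ X fun x => ((f x)⁻¹ : ℂˣ)) fun y v => by
    simp [scalar₁, X.proj_proj, map_sum, Finset.sum_ite_eq]
  hom_inv_id := by
    refine hom_ext (lin_ext fun x v hv => ?_)
    simp [scalar₁_apply _ _ hv]
  inv_hom_id := by
    refine hom_ext (lin_ext fun x v hv => ?_)
    simp [scalar₁_apply _ _ hv]

/-! ### The monoidal structure -/

/-- The tensor product: the component of degree `z` is `⨁_{x + y = z} V_x ⊗ W_y`. -/
abbrev tensorObj (X Y : GVec ω) : GVec ω where
  carrier := X.carrier ⊗[ℂ] Y.carrier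
  proj z := scalar₂ X Y fun x y => if x + y = z then 1 else 0
  proj_proj z z' v := by
    suffices h : (scalar₂ X Y fun x y => if x + y = z then 1 else 0) ∘ₗ
        (scalar₂ X Y fun x y => if x + y = z' then 1 else 0) =
        if z = z' then scalar₂ X Y fun x y => if x + y = z' then 1 else 0 else 0 by
      have h' := LinearMap.congr_fun h v
      rw [LinearMap.comp_apply] at h'
      rw [h']; split_ifs <;> rfl
    refine lin_ext₂ fun x v hv y w hw => ?_
    rw [LinearMap.comp_apply, scalar₂_apply _ _ _ hv hw, map_smul, scalar₂_apply _ _ _ hv hw]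
    by_cases h1 : x + y = z' <;> by_cases h2 : x + y = z <;> by_cases h3 : z = z' <;>
      simp [h1, h2, h3, scalar₂_apply _ _ _ hv hw] <;> simp_all
  sum_proj v := by
    suffices h : ∑ z, (scalar₂ X Y fun x y => if x + y = z then 1 else 0) = LinearMap.id by
      simpa using LinearMap.congr_fun h v
    refine lin_ext₂ fun x v hv y w hw => ?_
    simp [scalar₂_apply _ _ _ hv hw]

/-- The unit object: `ℂ` in degree `0`. -/
abbrev tensorUnit (ω : ThreeCocycle S) : GVec ω where
  carrier := ℂ
  proj x := if x = 0 then LinearMap.id else 0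
  proj_proj x y v := by
    by_cases h1 : x = 0 <;> by_cases h2 : y = 0 <;> by_cases h3 : x = y <;> simp_all
  sum_proj v := by
    have h : ∀ x : S, (if x = 0 then LinearMap.id else 0 : ℂ →ₗ[ℂ] ℂ) v = if x = 0 then v else 0 :=
      fun x => by split_ifs <;> rfl
    simp [h]

theorem IsHomog.tmul {X Y : GVec ω} {x y : S} {v : X.carrier} {w : Y.carrier}
    (hv : X.IsHomog x v) (hw : Y.IsHomog y w) : (tensorObj X Y).IsHomog (x + y) (v ⊗ₜ w) := by
  change scalar₂ X Y _ (v ⊗ₜ w) = _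
  simp [scalar₂_apply _ _ _ hv hw]

theorem isHomog_unit (c : ℂ) : (tensorUnit ω).IsHomog 0 c := by
  simp [IsHomog, tensorUnit]

/-- A linear map that sends homogeneous vectors to homogeneous vectors of the same degree
preserves the grading. -/
theorem comm_of_isHomog {X Y : GVec ω} (f : X.carrier →ₗ[ℂ] Y.carrier)
    (h : ∀ x v, X.IsHomog x v → Y.IsHomog x (f v)) (x : S) (v : X.carrier) :
    f (X.proj x v) = Y.proj x (f v) := by
  suffices h' : f ∘ₗ X.proj x = Y.proj x ∘ₗ f from LinearMap.congr_fun h' v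
  refine lin_ext fun y w hw => ?_
  rw [LinearMap.comp_apply, LinearMap.comp_apply, hw.proj, (h y w hw).proj]
  split_ifs <;> simp

theorem comm_of_isHomog₂ {X Y Z : GVec ω} (f : X.carrier ⊗[ℂ] Y.carrier →ₗ[ℂ] Z.carrier)
    (h : ∀ x v, X.IsHomog x v → ∀ y w, Y.IsHomog y w → Z.IsHomog (x + y) (f (v ⊗ₜ w)))
    (a : S) (v : (tensorObj X Y).carrier) :
    f ((tensorObj X Y).proj a v) = Z.proj a (f v) := by
  suffices h' : f ∘ₗ (tensorObj X Y).proj a = Z.proj a ∘ₗ f from LinearMap.congr_fun h' v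
  refine lin_ext₂ fun x v hv y w hw => ?_
  rw [LinearMap.comp_apply, LinearMap.comp_apply, (hv.tmul hw).proj, (h x v hv y w hw).proj]
  split_ifs <;> simp

theorem IsHomog.smul {X : GVec ω} {x : S} {v : X.carrier} (hv : X.IsHomog x v) (c : ℂ) :
    X.IsHomog x (c • v) := by
  simp only [IsHomog] at hv ⊢
  rw [map_smul, hv]

/-- The tensor product of morphisms. -/
def tensorHom {X X' Y Y' : GVec ω} (f : X ⟶ X') (g : Y ⟶ Y') :
    tensorObj X Y ⟶ tensorObj X' Y' :=
  ofLin (X := tensorObj X Y) (Y := tensorObj X' Y') (TensorProduct.map (lin f) (lin g))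
    (comm_of_isHomog₂ (Z := tensorObj X' Y') _
      fun _ _ hv _ _ hw => (hv.map f).tmul (hw.map g))

theorem comm_of_isHomog₃ {X Y Z W : GVec ω}
    (f : (X.carrier ⊗[ℂ] Y.carrier) ⊗[ℂ] Z.carrier →ₗ[ℂ] W.carrier)
    (h : ∀ x v, X.IsHomog x v → ∀ y w, Y.IsHomog y w → ∀ z t, Z.IsHomog z t →
      W.IsHomog (x + y + z) (f ((v ⊗ₜ w) ⊗ₜ t)))
    (a : S) (v : (tensorObj (tensorObj X Y) Z).carrier) :
    f ((tensorObj (tensorObj X Y) Z).proj a v) = W.proj a (f v) := by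
  suffices h' : f ∘ₗ (tensorObj (tensorObj X Y) Z).proj a = W.proj a ∘ₗ f from
    LinearMap.congr_fun h' v
  refine lin_ext₃ fun x v hv y w hw z t ht => ?_
  rw [LinearMap.comp_apply, LinearMap.comp_apply, ((hv.tmul hw).tmul ht).proj,
    (h x v hv y w hw z t ht).proj]
  split_ifs <;> simp

theorem comm_of_isHomog₃' {X Y Z W : GVec ω}
    (f : X.carrier ⊗[ℂ] (Y.carrier ⊗[ℂ] Z.carrier) →ₗ[ℂ] W.carrier)
    (h : ∀ x v, X.IsHomog x v → ∀ y w, Y.IsHomog y w → ∀ z t, Z.IsHomog z t →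
      W.IsHomog (x + (y + z)) (f (v ⊗ₜ (w ⊗ₜ t))))
    (a : S) (v : (tensorObj X (tensorObj Y Z)).carrier) :
    f ((tensorObj X (tensorObj Y Z)).proj a v) = W.proj a (f v) := by
  suffices h' : f ∘ₗ (tensorObj X (tensorObj Y Z)).proj a = W.proj a ∘ₗ f from
    LinearMap.congr_fun h' v
  refine lin_ext₃' fun x v hv y w hw z t ht => ?_
  rw [LinearMap.comp_apply, LinearMap.comp_apply, (hv.tmul (hw.tmul ht)).proj,
    (h x v hv y w hw z t ht).proj]
  split_ifs <;> simp

/-- On vectors of degrees `x`, `y`, `z`: the usual rebracketing times `ω x y z`. -/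
def assocHom (X Y Z : GVec ω) : (X.carrier ⊗[ℂ] Y.carrier) ⊗[ℂ] Z.carrier →ₗ[ℂ]
    X.carrier ⊗[ℂ] (Y.carrier ⊗[ℂ] Z.carrier) :=
  (TensorProduct.assoc ℂ X.carrier Y.carrier Z.carrier).toLinearMap ∘ₗ
    scalar₃ X Y Z fun x y z => ω.val x y z

/-- The inverse of `assocHom`. -/
def assocInv (X Y Z : GVec ω) : X.carrier ⊗[ℂ] (Y.carrier ⊗[ℂ] Z.carrier) →ₗ[ℂ]
    (X.carrier ⊗[ℂ] Y.carrier) ⊗[ℂ] Z.carrier :=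
  (scalar₃ X Y Z fun x y z => ((ω.val x y z)⁻¹ : ℂˣ)) ∘ₗ
    (TensorProduct.assoc ℂ X.carrier Y.carrier Z.carrier).symm.toLinearMap

section
variable {X Y Z : GVec ω} {x y z : S} {v : X.carrier} {w : Y.carrier} {t : Z.carrier}

theorem assocHom_apply (hv : X.IsHomog x v) (hw : Y.IsHomog y w) (ht : Z.IsHomog z t) :
    assocHom X Y Z ((v ⊗ₜ w) ⊗ₜ t) = (ω.val x y z : ℂ) • (v ⊗ₜ (w ⊗ₜ t)) := by
  simp [assocHom, scalar₃_apply _ _ _ _ hv hw ht]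

theorem assocInv_apply (hv : X.IsHomog x v) (hw : Y.IsHomog y w) (ht : Z.IsHomog z t) :
    assocInv X Y Z (v ⊗ₜ (w ⊗ₜ t)) = ((ω.val x y z)⁻¹ : ℂˣ).val • ((v ⊗ₜ w) ⊗ₜ t) := by
  simp [assocInv, scalar₃_apply _ _ _ _ hv hw ht]
end

/-- The associator of the monoidal structure twisted by `ω`. -/
def associator (X Y Z : GVec ω) :
    tensorObj (tensorObj X Y) Z ≅ tensorObj X (tensorObj Y Z) where
  hom := ofLin (X := tensorObj (tensorObj X Y) Z) (Y := tensorObj X (tensorObj Y Z))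
    (assocHom X Y Z)
    (comm_of_isHomog₃ (W := tensorObj X (tensorObj Y Z)) _ fun x v hv y w hw z t ht => by
      rw [assocHom_apply hv hw ht, add_assoc]
      exact (hv.tmul (hw.tmul ht)).smul _)
  inv := ofLin (X := tensorObj X (tensorObj Y Z)) (Y := tensorObj (tensorObj X Y) Z)
    (assocInv X Y Z)
    (comm_of_isHomog₃' (W := tensorObj (tensorObj X Y) Z) _ fun x v hv y w hw z t ht => by
      rw [assocInv_apply hv hw ht, ← add_assoc]
      exact ((hv.tmul hw).tmul ht).smul _)
  hom_inv_id := by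
    refine hom_ext (lin_ext₃ fun x v hv y w hw z t ht => ?_)
    change assocInv X Y Z (assocHom X Y Z ((v ⊗ₜ w) ⊗ₜ t)) = (v ⊗ₜ w) ⊗ₜ t
    rw [assocHom_apply hv hw ht, map_smul, assocInv_apply hv hw ht, smul_smul,
      ← Units.val_mul, mul_inv_cancel, Units.val_one, one_smul]
  inv_hom_id := by
    refine hom_ext (lin_ext₃' fun x v hv y w hw z t ht => ?_)
    change assocHom X Y Z (assocInv X Y Z (v ⊗ₜ (w ⊗ₜ t))) = v ⊗ₜ (w ⊗ₜ t)
    rw [assocInv_apply hv hw ht, map_smul, assocHom_apply hv hw ht, smul_smul,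
      ← Units.val_mul, inv_mul_cancel, Units.val_one, one_smul]

/-- An isomorphism given by a linear equivalence that preserves the grading. -/
def isoOfEquiv {X Y : GVec ω} (e : X.carrier ≃ₗ[ℂ] Y.carrier)
    (h : ∀ x v, e (X.proj x v) = Y.proj x (e v)) : X ≅ Y where
  hom := ofLin e.toLinearMap h
  inv := ofLin e.symm.toLinearMap fun x v => by
    apply e.injective
    simpa using (h x (e.symm v)).symm
  hom_inv_id := by ext v; simp
  inv_hom_id := by ext v; simp

def leftUnitor (X : GVec ω) : tensorObj (tensorUnit ω) X ≅ X :=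
  isoOfEquiv (X := tensorObj (tensorUnit ω) X) (TensorProduct.lid ℂ X.carrier)
    (comm_of_isHomog₂ (X := tensorUnit ω) (Y := X) (Z := X)
      (TensorProduct.lid ℂ X.carrier).toLinearMap fun x v hv y w hw => by
        by_cases hx : x = 0
        · subst hx
          simpa using hw.smul v
        · have : v = 0 := by simpa [IsHomog, hx] using hv.symm
          simp [this, IsHomog])

def rightUnitor (X : GVec ω) : tensorObj X (tensorUnit ω) ≅ X :=
  isoOfEquiv (X := tensorObj X (tensorUnit ω)) (TensorProduct.rid ℂ X.carrier)
    (comm_of_isHomog₂ (X := X) (Y := tensorUnit ω) (Z := X)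
      (TensorProduct.rid ℂ X.carrier).toLinearMap fun y w hw x v hv => by
        by_cases hx : x = 0
        · subst hx
          simpa using hw.smul v
        · have : v = 0 := by simpa [IsHomog, hx] using hv.symm
          simp [this, IsHomog])

instance : MonoidalCategoryStruct (GVec ω) where
  tensorObj := tensorObj
  tensorHom := tensorHom
  whiskerLeft X _ _ f := tensorHom (𝟙 X) f
  whiskerRight f Y := tensorHom f (𝟙 Y)
  tensorUnit := tensorUnit ω
  associator := associator
  leftUnitor := leftUnitor
  rightUnitor := rightUnitor

instance : MonoidalCategory (GVec ω) := MonoidalCategory.ofTensorHom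
  (id_tensorHom_id := fun X Y => hom_ext TensorProduct.map_id)
  (id_tensorHom := fun _ _ _ _ => rfl)
  (tensorHom_id := fun _ _ => rfl)
  (tensorHom_comp_tensorHom := fun f₁ f₂ g₁ g₂ =>
    hom_ext (TensorProduct.map_comp (lin g₁) (lin g₂) (lin f₁) (lin f₂)).symm)
  (associator_naturality := fun {X₁ X₂ X₃ Y₁ Y₂ Y₃} f₁ f₂ f₃ => by
    refine hom_ext (lin_ext₃ fun x v hv y w hw z t ht => ?_)
    change assocHom Y₁ Y₂ Y₃ ((lin f₁ v ⊗ₜ lin f₂ w) ⊗ₜ lin f₃ t) =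
      TensorProduct.map (lin f₁) (TensorProduct.map (lin f₂) (lin f₃))
        (assocHom X₁ X₂ X₃ ((v ⊗ₜ w) ⊗ₜ t))
    rw [assocHom_apply hv hw ht, assocHom_apply (hv.map f₁) (hw.map f₂) (ht.map f₃), map_smul]
    rfl)
  (leftUnitor_naturality := fun {X Y} f => by
    refine hom_ext (TensorProduct.ext' fun c v => ?_)
    exact (map_smul (lin f) (show ℂ from c) v).symm)
  (rightUnitor_naturality := fun {X Y} f => by
    refine hom_ext (TensorProduct.ext' fun v c => ?_)
    exact (map_smul (lin f) (show ℂ from c) v).symm)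
  (pentagon := fun W X Y Z => by
    refine hom_ext (lin_ext₄ fun x v hv y w hw z t ht a s hs => ?_)
    change TensorProduct.map LinearMap.id (assocHom X Y Z)
      (assocHom W (tensorObj X Y) Z (TensorProduct.map (assocHom W X Y) LinearMap.id
        (((v ⊗ₜ w) ⊗ₜ t) ⊗ₜ s))) =
      assocHom W X (tensorObj Y Z) (assocHom (tensorObj W X) Y Z (((v ⊗ₜ w) ⊗ₜ t) ⊗ₜ s))
    rw [TensorProduct.map_tmul, assocHom_apply hv hw ht, LinearMap.id_apply,
      ← TensorProduct.smul_tmul', map_smul, assocHom_apply hv (hw.tmul ht) hs, map_smul,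
      map_smul, TensorProduct.map_tmul, assocHom_apply hw ht hs, LinearMap.id_apply,
      TensorProduct.tmul_smul, smul_smul, smul_smul, assocHom_apply (hv.tmul hw) ht hs,
      map_smul, assocHom_apply hv hw (ht.tmul hs), smul_smul, ← Units.val_mul,
      ← Units.val_mul, ← Units.val_mul, ω.pentagon])
  (triangle := fun X Y => by
    refine hom_ext (lin_ext₃ (Y := tensorUnit ω) fun x v hv y c hc z t ht => ?_)
    change TensorProduct.map LinearMap.id (TensorProduct.lid ℂ Y.carrier).toLinearMap
      (assocHom X (tensorUnit ω) Y ((v ⊗ₜ c) ⊗ₜ t)) =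
      TensorProduct.map (TensorProduct.rid ℂ X.carrier).toLinearMap LinearMap.id
        ((v ⊗ₜ c) ⊗ₜ t)
    by_cases hy : y = 0
    · subst hy
      rw [assocHom_apply hv hc ht, ω.val_zero]
      simp [TensorProduct.smul_tmul]
    · have : c = 0 := by simpa [IsHomog, hy] using hc.symm
      simp [this])

section
variable {X X' Y Y' : GVec ω}

theorem lin_tensorHom (f : X ⟶ X') (g : Y ⟶ Y') :
    lin (f ⊗ₘ g) = TensorProduct.map (lin f) (lin g) := rfl
theorem lin_whiskerLeft (f : Y ⟶ Y') :
    lin (X ◁ f) = TensorProduct.map LinearMap.id (lin f) := rfl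
theorem lin_whiskerRight (f : X ⟶ X') :
    lin (f ▷ Y) = TensorProduct.map (lin f) LinearMap.id := rfl
theorem lin_associator_hom (X Y Z : GVec ω) : lin (α_ X Y Z).hom = assocHom X Y Z := rfl
theorem lin_associator_inv (X Y Z : GVec ω) : lin (α_ X Y Z).inv = assocInv X Y Z := rfl
theorem lin_leftUnitor_hom (X : GVec ω) :
    lin (λ_ X).hom = (TensorProduct.lid ℂ X.carrier).toLinearMap := rfl
theorem lin_rightUnitor_hom (X : GVec ω) :
    lin (ρ_ X).hom = (TensorProduct.rid ℂ X.carrier).toLinearMap := rfl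
end

instance : MonoidalPreadditive (GVec ω) where
  whiskerLeft_zero := hom_ext (TensorProduct.map_zero_right _)
  zero_whiskerRight := hom_ext (TensorProduct.map_zero_left _)
  whiskerLeft_add _ _ := hom_ext (TensorProduct.map_add_right _ _ _)
  add_whiskerRight _ _ := hom_ext (TensorProduct.map_add_left _ _ _)

instance : MonoidalLinear ℂ (GVec ω) where
  whiskerLeft_smul _ _ _ _ _ := hom_ext (TensorProduct.map_smul_right _ _ _)
  smul_whiskerRight _ _ _ _ _ := hom_ext (TensorProduct.map_smul_left _ _ _)

end GVec

/-! ### The linear structure of the Drinfeld center -/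

section Center
variable {C : Type*} [Category C] [MonoidalCategory C] [Preadditive C] [MonoidalPreadditive C]

instance centerZero (X Y : Center C) : Zero (X ⟶ Y) :=
  ⟨⟨0, fun U => by
    rw [MonoidalPreadditive.zero_whiskerRight, MonoidalPreadditive.whiskerLeft_zero,
      Limits.zero_comp, Limits.comp_zero]⟩⟩

instance centerAdd (X Y : Center C) : Add (X ⟶ Y) :=
  ⟨fun f g => ⟨f.f + g.f, fun U => by
    rw [MonoidalPreadditive.add_whiskerRight, MonoidalPreadditive.whiskerLeft_add,
      Preadditive.add_comp, Preadditive.comp_add, f.comm, g.comm]⟩⟩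

instance centerNeg (X Y : Center C) : Neg (X ⟶ Y) :=
  ⟨fun f => ⟨-f.f, fun U => by
    have h₁ : (-f.f) ▷ U = -(f.f ▷ U) :=
      map_neg (AddMonoidHom.mk' (fun h : X.1 ⟶ Y.1 => h ▷ U)
        fun _ _ => MonoidalPreadditive.add_whiskerRight _ _) f.f
    have h₂ : U ◁ (-f.f) = -(U ◁ f.f) :=
      map_neg (AddMonoidHom.mk' (fun h : X.1 ⟶ Y.1 => U ◁ h)
        fun _ _ => MonoidalPreadditive.whiskerLeft_add _ _) f.f
    rw [h₁, h₂, Preadditive.neg_comp, Preadditive.comp_neg, f.comm]⟩⟩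

instance centerAddCommGroup (X Y : Center C) : AddCommGroup (X ⟶ Y) where
  add_assoc f g h := Center.ext _ _ (add_assoc f.f g.f h.f)
  zero_add f := Center.ext _ _ (zero_add f.f)
  add_zero f := Center.ext _ _ (add_zero f.f)
  neg_add_cancel f := Center.ext _ _ (neg_add_cancel f.f)
  add_comm f g := Center.ext _ _ (add_comm f.f g.f)
  nsmul := nsmulRec
  zsmul := zsmulRec

theorem center_add_f {X Y : Center C} (f g : X ⟶ Y) : (f + g).f = f.f + g.f := rfl

instance centerPreadditive : Preadditive (Center C) where
  homGroup := centerAddCommGroup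
  add_comp _ _ _ f g h := Center.ext _ _ (Preadditive.add_comp _ _ _ f.f g.f h.f)
  comp_add _ _ _ f g h := Center.ext _ _ (Preadditive.comp_add _ _ _ f.f g.f h.f)

variable [Linear ℂ C] [MonoidalLinear ℂ C]

instance centerModule (X Y : Center C) : Module ℂ (X ⟶ Y) where
  smul c f := ⟨c • f.f, fun U => by
    rw [MonoidalLinear.smul_whiskerRight, MonoidalLinear.whiskerLeft_smul,
      Linear.smul_comp, Linear.comp_smul, f.comm]⟩
  one_smul f := Center.ext _ _ (one_smul ℂ f.f)
  mul_smul c d f := Center.ext _ _ (mul_smul c d f.f)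
  smul_zero c := Center.ext _ _ (smul_zero c)
  smul_add c f g := Center.ext _ _ (smul_add c f.f g.f)
  add_smul c d f := Center.ext _ _ (add_smul c d f.f)
  zero_smul f := Center.ext _ _ (zero_smul ℂ f.f)

instance centerLinear : Linear ℂ (Center C) where
  homModule := centerModule
  smul_comp _ _ _ c f g := Center.ext _ _ (Linear.smul_comp _ _ _ c f.f g.f)
  comp_smul _ _ _ f c g := Center.ext _ _ (Linear.comp_smul _ _ _ f.f c g.f)
end Center

namespace GVec
variable {S : Type} [AddCommGroup S] [Fintype S] [DecidableEq S] {ω : ThreeCocycle S}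

/-- The automorphism multiplying the component of bidegree `(x, y)` by `f x y`. -/
def scalarIso₂ (X Y : GVec ω) (f : S → S → ℂˣ) : X ⊗ Y ≅ X ⊗ Y where
  hom := ofLin (X := tensorObj X Y) (Y := tensorObj X Y) (scalar₂ X Y fun x y => f x y)
    (comm_of_isHomog₂ (Z := tensorObj X Y) _ fun x v hv y w hw => by
      rw [scalar₂_apply _ _ _ hv hw]
      exact (hv.tmul hw).smul _)
  inv := ofLin (X := tensorObj X Y) (Y := tensorObj X Y)
    (scalar₂ X Y fun x y => ((f x y)⁻¹ : ℂˣ))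
    (comm_of_isHomog₂ (Z := tensorObj X Y) _ fun x v hv y w hw => by
      rw [scalar₂_apply _ _ _ hv hw]
      exact (hv.tmul hw).smul _)
  hom_inv_id := by
    refine hom_ext (lin_ext₂ fun x v hv y w hw => ?_)
    change scalar₂ X Y _ (scalar₂ X Y _ (v ⊗ₜ w)) = v ⊗ₜ w
    rw [scalar₂_apply _ _ _ hv hw, map_smul, scalar₂_apply _ _ _ hv hw, smul_smul,
      ← Units.val_mul, mul_inv_cancel, Units.val_one, one_smul]
  inv_hom_id := by
    refine hom_ext (lin_ext₂ fun x v hv y w hw => ?_)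
    change scalar₂ X Y _ (scalar₂ X Y _ (v ⊗ₜ w)) = v ⊗ₜ w
    rw [scalar₂_apply _ _ _ hv hw, map_smul, scalar₂_apply _ _ _ hv hw, smul_smul,
      ← Units.val_mul, inv_mul_cancel, Units.val_one, one_smul]

end GVec

variable {G S : Type} [AddCommGroup G] [AddCommGroup S] [Fintype S] [DecidableEq S]

/-- An equivariant object: a graded vector space with isomorphisms `u g : ρ_g X ⟶ X`, where `ρ_g`
is the identity on objects, such that `u g ∘ ρ_g (u h) = u (h + g) ∘ (ρ²_{g,h})_X`. -/
structure Equivariant (D : CrossedData G S) where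
  obj : GVec D.assoc
  u : G → (obj ≅ obj)
  u_comp : ∀ g h,
    (u h).hom ≫ (u g).hom = (GVec.scalarIso obj (D.compositor g h)).hom ≫ (u (h + g)).hom

namespace Equivariant
open GVec
variable {D : CrossedData G S}

/-- Morphisms of equivariant objects: those compatible with the isomorphisms `u g`. -/
def homs (X Y : Equivariant D) : Submodule ℂ (X.obj ⟶ Y.obj) where
  carrier := {f | ∀ g, (X.u g).hom ≫ f = f ≫ (Y.u g).hom}
  zero_mem' := fun g => by simp
  add_mem' := fun {f₁ f₂} h₁ h₂ g => by simp [h₁ g, h₂ g]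
  smul_mem' := fun c f h g => by simp [h g]

instance : Category (Equivariant D) where
  Hom X Y := homs X Y
  id X := ⟨𝟙 X.obj, fun g => by simp⟩
  comp f g := ⟨f.1 ≫ g.1, fun a => by
    rw [← Category.assoc, f.2, Category.assoc, g.2, Category.assoc]⟩

instance (X Y : Equivariant D) : AddCommGroup (X ⟶ Y) := inferInstanceAs (AddCommGroup (homs X Y))
instance (X Y : Equivariant D) : Module ℂ (X ⟶ Y) := inferInstanceAs (Module ℂ (homs X Y))

/-- The morphism of graded vector spaces underlying a morphism. -/
def mor {X Y : Equivariant D} (f : X ⟶ Y) : X.obj ⟶ Y.obj := Subtype.val f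

theorem u_mor {X Y : Equivariant D} (f : X ⟶ Y) (g : G) :
    (X.u g).hom ≫ mor f = mor f ≫ (Y.u g).hom := f.2 g

/-- The morphism given by a compatible morphism of graded vector spaces. -/
def ofMor {X Y : Equivariant D} (f : X.obj ⟶ Y.obj)
    (h : ∀ g, (X.u g).hom ≫ f = f ≫ (Y.u g).hom) : X ⟶ Y := ⟨f, h⟩

theorem hom_ext {X Y : Equivariant D} {f g : X ⟶ Y} (h : mor f = mor g) : f = g :=
  Subtype.ext h

theorem mor_comp {X Y Z : Equivariant D} (f : X ⟶ Y) (g : Y ⟶ Z) :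
    mor (f ≫ g) = mor f ≫ mor g := rfl
theorem mor_add {X Y : Equivariant D} (f g : X ⟶ Y) : mor (f + g) = mor f + mor g := rfl
theorem mor_smul {X Y : Equivariant D} (c : ℂ) (f : X ⟶ Y) : mor (c • f) = c • mor f := rfl

instance : Preadditive (Equivariant D) where
  add_comp _ _ _ f g h := hom_ext <| by simp only [mor_comp, mor_add, Preadditive.add_comp]
  comp_add _ _ _ f g h := hom_ext <| by simp only [mor_comp, mor_add, Preadditive.comp_add]

instance : Linear ℂ (Equivariant D) where
  smul_comp _ _ _ c f g := hom_ext <| by simp only [mor_comp, mor_smul, Linear.smul_comp]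
  comp_smul _ _ _ f c g := hom_ext <| by simp only [mor_comp, mor_smul, Linear.comp_smul]

/-- The isomorphism given by a compatible isomorphism of graded vector spaces. -/
def ofIso {X Y : Equivariant D} (e : X.obj ≅ Y.obj)
    (h : ∀ g, (X.u g).hom ≫ e.hom = e.hom ≫ (Y.u g).hom) : X ≅ Y where
  hom := ofMor e.hom h
  inv := ofMor e.inv fun g => by rw [Iso.eq_inv_comp, ← Category.assoc, ← h]; simp
  hom_inv_id := hom_ext e.hom_inv_id
  inv_hom_id := hom_ext e.inv_hom_id

/-- The linear map underlying `u g`. -/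
def act (X : Equivariant D) (g : G) : X.obj.carrier →ₗ[ℂ] X.obj.carrier := lin (X.u g).hom

theorem isHomog_act (X : Equivariant D) (g : G) {x : S} {v : X.obj.carrier}
    (hv : X.obj.IsHomog x v) : X.obj.IsHomog x (X.act g v) := hv.map _

theorem act_act (X : Equivariant D) (g h : G) {x : S} {v : X.obj.carrier}
    (hv : X.obj.IsHomog x v) :
    X.act g (X.act h v) = (D.compositor g h x : ℂ) • X.act (h + g) v := by
  have e := LinearMap.congr_fun (congrArg lin (X.u_comp g h)) v
  have e' : lin (scalarIso X.obj (D.compositor g h)).hom v = (D.compositor g h x : ℂ) • v :=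
    scalar₁_apply _ _ hv
  rw [lin_comp, lin_comp, LinearMap.comp_apply, LinearMap.comp_apply, e', map_smul] at e
  exact e

theorem mor_act {X Y : Equivariant D} (f : X ⟶ Y) (g : G) (v : X.obj.carrier) :
    lin (mor f) (X.act g v) = Y.act g (lin (mor f) v) :=
  LinearMap.congr_fun (congrArg lin (u_mor f g)) v

/-- The equivariant structure of a tensor product: `(u ⊗ v) g = (u g ⊗ v g) ∘ (ρ_g²)⁻¹`. -/
def tensorAct (X Y : Equivariant D) (g : G) :
    GVec.tensorObj X.obj Y.obj ≅ GVec.tensorObj X.obj Y.obj :=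
  (scalarIso₂ X.obj Y.obj (D.tensorator g)).symm ≪≫ (X.u g ⊗ᵢ Y.u g)

theorem tensorAct_apply (X Y : Equivariant D) (g : G) {x y : S} {v : X.obj.carrier}
    {w : Y.obj.carrier} (hv : X.obj.IsHomog x v) (hw : Y.obj.IsHomog y w) :
    lin (tensorAct X Y g).hom (v ⊗ₜ w) =
      ((D.tensorator g x y)⁻¹ : ℂˣ).val • (X.act g v ⊗ₜ Y.act g w) := by
  change TensorProduct.map (X.act g) (Y.act g) (scalar₂ _ _ _ (v ⊗ₜ w)) = _
  rw [scalar₂_apply _ _ _ hv hw, map_smul, TensorProduct.map_tmul]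

/-- The tensor product of equivariant objects. -/
abbrev tensorObj (X Y : Equivariant D) : Equivariant D where
  obj := GVec.tensorObj X.obj Y.obj
  u := tensorAct X Y
  u_comp g h := by
    refine GVec.hom_ext (lin_ext₂ fun x v hv y w hw => ?_)
    change lin (tensorAct X Y g).hom (lin (tensorAct X Y h).hom (v ⊗ₜ w)) =
      lin (tensorAct X Y (h + g)).hom (scalar₁ (GVec.tensorObj X.obj Y.obj) _ (v ⊗ₜ w))
    rw [tensorAct_apply _ _ _ hv hw, scalar₁_apply _ _ (hv.tmul hw), map_smul, map_smul,
      tensorAct_apply _ _ _ hv hw, tensorAct_apply _ _ _ (X.isHomog_act h hv) (Y.isHomog_act h hw),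
      X.act_act _ _ hv, Y.act_act _ _ hw, TensorProduct.smul_tmul_smul, ← Units.val_mul,
      smul_smul, smul_smul, smul_smul, ← Units.val_mul, ← Units.val_mul, ← Units.val_mul]
    congr 2
    have e := D.compositor_tensor g h x y
    rw [eq_mul_inv_iff_mul_eq, mul_assoc, mul_assoc, ← e]
    group

/-- The unit object, with the identity equivariant structure. -/
abbrev tensorUnit (D : CrossedData G S) : Equivariant D where
  obj := GVec.tensorUnit D.assoc
  u _ := Iso.refl _
  u_comp g h := by
    refine GVec.hom_ext (lin_ext fun x v hv => ?_)
    change v = scalar₁ (GVec.tensorUnit D.assoc) _ v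
    by_cases hx : x = 0
    · subst hx
      rw [scalar₁_apply _ _ hv, D.compositor_zero, Units.val_one, one_smul]
    · have : v = 0 := by simpa [IsHomog, hx, GVec.tensorUnit] using hv.symm
      simp [this]

theorem tensor_comp {X X' Y Y' : Equivariant D} (f : X ⟶ X') (f' : Y ⟶ Y') (g : G) :
    (tensorAct X Y g).hom ≫ (mor f ⊗ₘ mor f') =
      (mor f ⊗ₘ mor f') ≫ (tensorAct X' Y' g).hom := by
  refine GVec.hom_ext (lin_ext₂ fun x v hv y w hw => ?_)
  change TensorProduct.map (lin (mor f)) (lin (mor f')) (lin (tensorAct X Y g).hom (v ⊗ₜ w)) =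
    lin (tensorAct X' Y' g).hom (lin (mor f) v ⊗ₜ lin (mor f') w)
  rw [tensorAct_apply _ _ _ hv hw, tensorAct_apply _ _ _ (hv.map _) (hw.map _), map_smul,
    TensorProduct.map_tmul, mor_act, mor_act]

def tensorHom {X X' Y Y' : Equivariant D} (f : X ⟶ X') (f' : Y ⟶ Y') :
    tensorObj X Y ⟶ tensorObj X' Y' :=
  ofMor (X := tensorObj X Y) (Y := tensorObj X' Y') (mor f ⊗ₘ mor f') (tensor_comp f f')

/-- The associator is that of the underlying graded vector spaces. -/
def associator (X Y Z : Equivariant D) :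
    tensorObj (tensorObj X Y) Z ≅ tensorObj X (tensorObj Y Z) :=
  ofIso (X := tensorObj (tensorObj X Y) Z) (Y := tensorObj X (tensorObj Y Z))
    (α_ X.obj Y.obj Z.obj) fun g => by
      refine GVec.hom_ext (lin_ext₃ fun x v hv y w hw z t ht => ?_)
      change assocHom X.obj Y.obj Z.obj
        (lin (tensorAct (tensorObj X Y) Z g).hom ((v ⊗ₜ w) ⊗ₜ t)) =
        lin (tensorAct X (tensorObj Y Z) g).hom (assocHom X.obj Y.obj Z.obj ((v ⊗ₜ w) ⊗ₜ t))
      have h1 := tensorAct_apply (tensorObj X Y) Z g (hv.tmul hw) ht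
      have h2 := tensorAct_apply X (tensorObj Y Z) g hv (hw.tmul ht)
      have h3 : (tensorObj X Y).act g (v ⊗ₜ w) = _ := tensorAct_apply X Y g hv hw
      have h4 : (tensorObj Y Z).act g (w ⊗ₜ t) = _ := tensorAct_apply Y Z g hw ht
      rw [h3] at h1
      rw [h4] at h2
      refine (congrArg _ h1).trans (Eq.trans ?_ (congrArg _ (assocHom_apply hv hw ht)).symm)
      refine Eq.trans ?_ (map_smul (lin (tensorAct X (tensorObj Y Z) g).hom) _ _).symm
      refine Eq.trans ?_ (congrArg (fun q => ((D.assoc.val x y z : ℂˣ) : ℂ) • q) h2).symm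
      rw [map_smul, ← TensorProduct.smul_tmul', map_smul,
        assocHom_apply (X.isHomog_act g hv) (Y.isHomog_act g hw) (Z.isHomog_act g ht),
        TensorProduct.tmul_smul, smul_smul, smul_smul, smul_smul, smul_smul, ← Units.val_mul,
        ← Units.val_mul, ← Units.val_mul, ← Units.val_mul]
      congr 2
      have e := D.tensorator_assoc g x y z
      apply Additive.ofMul.injective
      replace e := congrArg Additive.ofMul e
      simp only [ofMul_mul, ofMul_inv] at e ⊢
      grind

def leftUnitor (X : Equivariant D) : tensorObj (tensorUnit D) X ≅ X :=
  ofIso (X := tensorObj (tensorUnit D) X) (λ_ X.obj) fun g => by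
    refine GVec.hom_ext (lin_ext₂ (X := GVec.tensorUnit D.assoc) fun x v hv y w hw => ?_)
    change TensorProduct.lid ℂ X.obj.carrier
      (lin (tensorAct (tensorUnit D) X g).hom (v ⊗ₜ w)) =
      X.act g (TensorProduct.lid ℂ X.obj.carrier (v ⊗ₜ w))
    by_cases hx : x = 0
    · subst hx
      have h := tensorAct_apply (tensorUnit D) X g hv hw
      rw [D.tensorator_zero_left, inv_one, Units.val_one, one_smul] at h
      refine (congrArg _ h).trans ?_
      exact (map_smul (X.act g) (show ℂ from v) w).symm
    · have : v = 0 := by simpa [IsHomog, hx, GVec.tensorUnit] using hv.symm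
      subst this
      rw [TensorProduct.zero_tmul, map_zero, map_zero, map_zero]

def rightUnitor (X : Equivariant D) : tensorObj X (tensorUnit D) ≅ X :=
  ofIso (X := tensorObj X (tensorUnit D)) (ρ_ X.obj) fun g => by
    refine GVec.hom_ext (lin_ext₂ (Y := GVec.tensorUnit D.assoc) fun y w hw x v hv => ?_)
    change TensorProduct.rid ℂ X.obj.carrier
      (lin (tensorAct X (tensorUnit D) g).hom (w ⊗ₜ v)) =
      X.act g (TensorProduct.rid ℂ X.obj.carrier (w ⊗ₜ v))
    by_cases hx : x = 0
    · subst hx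
      have h := tensorAct_apply X (tensorUnit D) g hw hv
      rw [D.tensorator_zero_right, inv_one, Units.val_one, one_smul] at h
      refine (congrArg _ h).trans ?_
      exact (map_smul (X.act g) (show ℂ from v) w).symm
    · have : v = 0 := by simpa [IsHomog, hx, GVec.tensorUnit] using hv.symm
      subst this
      rw [TensorProduct.tmul_zero, map_zero, map_zero, map_zero]

instance : MonoidalCategoryStruct (Equivariant D) where
  tensorObj := tensorObj
  tensorHom := tensorHom
  whiskerLeft X _ _ f := tensorHom (𝟙 X) f
  whiskerRight f Y := tensorHom f (𝟙 Y)
  tensorUnit := tensorUnit D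
  associator := associator
  leftUnitor := leftUnitor
  rightUnitor := rightUnitor

instance : MonoidalCategory (Equivariant D) := MonoidalCategory.ofTensorHom
  (id_tensorHom_id := fun X Y => hom_ext (MonoidalCategory.id_tensorHom_id X.obj Y.obj))
  (id_tensorHom := fun _ _ _ _ => rfl)
  (tensorHom_id := fun _ _ => rfl)
  (tensorHom_comp_tensorHom := fun f₁ f₂ g₁ g₂ => hom_ext
    (MonoidalCategory.tensorHom_comp_tensorHom (mor f₁) (mor f₂) (mor g₁) (mor g₂)))
  (associator_naturality := fun f₁ f₂ f₃ => hom_ext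
    (MonoidalCategory.associator_naturality (mor f₁) (mor f₂) (mor f₃)))
  (leftUnitor_naturality := fun {X Y} f => hom_ext
    ((congrArg (· ≫ (λ_ Y.obj).hom) (MonoidalCategory.id_tensorHom _ (mor f))).trans
      (MonoidalCategory.leftUnitor_naturality (mor f))))
  (rightUnitor_naturality := fun {X Y} f => hom_ext
    ((congrArg (· ≫ (ρ_ Y.obj).hom) (MonoidalCategory.tensorHom_id (mor f) _)).trans
      (MonoidalCategory.rightUnitor_naturality (mor f))))
  (pentagon := fun W X Y Z => hom_ext (by
    have h := MonoidalCategory.pentagon W.obj X.obj Y.obj Z.obj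
    rw [← MonoidalCategory.id_tensorHom, ← MonoidalCategory.tensorHom_id] at h
    exact h))
  (triangle := fun X Y => hom_ext (by
    have h := MonoidalCategory.triangle X.obj Y.obj
    rw [← MonoidalCategory.id_tensorHom, ← MonoidalCategory.tensorHom_id] at h
    exact h))

/-! ### The braiding -/

/-- `X ⊗ Y ⟶ Y ⊗ ρ_h X ⟶ Y ⊗ X`, the crossed braiding followed by `Y ⊗ u h`, where `h` is the
`G`-degree of `Y`: on vectors of degrees `x` and `y`, `v ⊗ w ↦ c(x, y) • w ⊗ u_{deg y} v`. -/
def braidLin (X Y : Equivariant D) : X.obj.carrier ⊗[ℂ] Y.obj.carrier →ₗ[ℂ]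
    Y.obj.carrier ⊗[ℂ] X.obj.carrier :=
  ∑ x, ∑ y, (D.braid x y : ℂ) •
    (TensorProduct.map (Y.obj.proj y) (X.act (D.deg y) ∘ₗ X.obj.proj x) ∘ₗ
      (TensorProduct.comm ℂ X.obj.carrier Y.obj.carrier).toLinearMap)

/-- The inverse of `braidLin`. -/
def braidInvLin (X Y : Equivariant D) : Y.obj.carrier ⊗[ℂ] X.obj.carrier →ₗ[ℂ]
    X.obj.carrier ⊗[ℂ] Y.obj.carrier :=
  ∑ x, ∑ y, ((D.braid x y)⁻¹ : ℂˣ).val •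
    (TensorProduct.map (lin (X.u (D.deg y)).inv ∘ₗ X.obj.proj x) (Y.obj.proj y) ∘ₗ
      (TensorProduct.comm ℂ Y.obj.carrier X.obj.carrier).toLinearMap)

theorem braidLin_apply {X Y : Equivariant D} {x y : S} {v : X.obj.carrier}
    {w : Y.obj.carrier} (hv : X.obj.IsHomog x v) (hw : Y.obj.IsHomog y w) :
    braidLin X Y (v ⊗ₜ w) =
    (D.braid x y : ℂ) • (w ⊗ₜ X.act (D.deg y) v) := by
  simp only [braidLin, LinearMap.sum_apply, LinearMap.smul_apply, LinearMap.comp_apply,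
    LinearEquiv.coe_coe, TensorProduct.comm_tmul, TensorProduct.map_tmul, hv.proj, hw.proj]
  rw [Finset.sum_eq_single x, Finset.sum_eq_single y] <;> simp +contextual

theorem braidInvLin_apply {X Y : Equivariant D} {x y : S} {v : X.obj.carrier}
    {w : Y.obj.carrier} (hv : X.obj.IsHomog x v) (hw : Y.obj.IsHomog y w) :
    braidInvLin X Y (w ⊗ₜ v) =
    ((D.braid x y)⁻¹ : ℂˣ).val • (lin (X.u (D.deg y)).inv v ⊗ₜ w) := by
  simp only [braidInvLin, LinearMap.sum_apply, LinearMap.smul_apply, LinearMap.comp_apply,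
    LinearEquiv.coe_coe, TensorProduct.comm_tmul, TensorProduct.map_tmul, hv.proj, hw.proj]
  rw [Finset.sum_eq_single x, Finset.sum_eq_single y] <;> simp +contextual

theorem inv_act (X : Equivariant D) (g : G) (v : X.obj.carrier) :
    lin (X.u g).inv (X.act g v) = v :=
  LinearMap.congr_fun (congrArg lin (X.u g).hom_inv_id) v

theorem act_inv (X : Equivariant D) (g : G) (v : X.obj.carrier) :
    X.act g (lin (X.u g).inv v) = v :=
  LinearMap.congr_fun (congrArg lin (X.u g).inv_hom_id) v

/-- The braiding on the underlying graded vector spaces. -/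
def braidObjIso (X Y : Equivariant D) : X.obj ⊗ Y.obj ≅ Y.obj ⊗ X.obj where
  hom := ofLin (X := GVec.tensorObj X.obj Y.obj) (Y := GVec.tensorObj Y.obj X.obj)
    (braidLin X Y) (comm_of_isHomog₂ (Z := GVec.tensorObj Y.obj X.obj) _ fun x v hv y w hw => by
      rw [braidLin_apply hv hw, add_comm]
      exact (hw.tmul (X.isHomog_act _ hv)).smul _)
  inv := ofLin (X := GVec.tensorObj Y.obj X.obj) (Y := GVec.tensorObj X.obj Y.obj)
    (braidInvLin X Y) (comm_of_isHomog₂ (Z := GVec.tensorObj X.obj Y.obj) _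
      fun y w hw x v hv => by
        rw [braidInvLin_apply hv hw, add_comm]
        exact ((hv.map _).tmul hw).smul _)
  hom_inv_id := by
    refine GVec.hom_ext (lin_ext₂ fun x v hv y w hw => ?_)
    change braidInvLin X Y (braidLin X Y (v ⊗ₜ w)) = v ⊗ₜ w
    rw [braidLin_apply hv hw, map_smul, braidInvLin_apply (X.isHomog_act _ hv) hw, inv_act,
      smul_smul, ← Units.val_mul, mul_inv_cancel, Units.val_one, one_smul]
  inv_hom_id := by
    refine GVec.hom_ext (lin_ext₂ fun y w hw x v hv => ?_)
    change braidLin X Y (braidInvLin X Y (w ⊗ₜ v)) = w ⊗ₜ v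
    rw [braidInvLin_apply hv hw, map_smul, braidLin_apply (hv.map _) hw, act_inv,
      smul_smul, ← Units.val_mul, inv_mul_cancel, Units.val_one, one_smul]

/-- The braiding of the equivariantisation. -/
def braidIso (X Y : Equivariant D) : X ⊗ Y ≅ Y ⊗ X :=
  ofIso (X := tensorObj X Y) (Y := tensorObj Y X) (braidObjIso X Y) fun g => by
    refine GVec.hom_ext (lin_ext₂ fun x v hv y w hw => ?_)
    change braidLin X Y (lin (tensorAct X Y g).hom (v ⊗ₜ w)) =
      lin (tensorAct Y X g).hom (braidLin X Y (v ⊗ₜ w))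
    rw [tensorAct_apply _ _ _ hv hw, braidLin_apply hv hw, map_smul, map_smul,
      braidLin_apply (X.isHomog_act _ hv) (Y.isHomog_act _ hw),
      tensorAct_apply _ _ _ hw (X.isHomog_act _ hv), X.act_act _ _ hv, X.act_act _ _ hv,
      TensorProduct.tmul_smul, TensorProduct.tmul_smul, smul_smul, smul_smul, smul_smul,
      smul_smul, ← Units.val_mul, ← Units.val_mul, ← Units.val_mul, ← Units.val_mul, add_comm g]
    congr 2
    have e := D.braid_equivariant g x y
    apply Additive.ofMul.injective
    replace e := congrArg Additive.ofMul e
    simp only [ofMul_mul, ofMul_inv] at e ⊢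
    grind

theorem lin_braidIso (X Y : Equivariant D) : lin (mor (braidIso X Y).hom) = braidLin X Y := rfl

instance : BraidedCategory (Equivariant D) where
  braiding := braidIso
  braiding_naturality_right X {Y Z} f := by
    refine hom_ext (GVec.hom_ext (lin_ext₂ fun x v hv y w hw => ?_))
    change braidLin X Z (v ⊗ₜ lin (mor f) w) =
      TensorProduct.map (lin (mor f)) LinearMap.id (braidLin X Y (v ⊗ₜ w))
    rw [braidLin_apply hv hw, braidLin_apply hv (hw.map _), map_smul]
    rfl
  braiding_naturality_left {X Y} f Z := by
    refine hom_ext (GVec.hom_ext (lin_ext₂ fun x v hv y w hw => ?_))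
    change braidLin Y Z (lin (mor f) v ⊗ₜ w) =
      TensorProduct.map LinearMap.id (lin (mor f)) (braidLin X Z (v ⊗ₜ w))
    rw [braidLin_apply hv hw, braidLin_apply (hv.map _) hw, map_smul, TensorProduct.map_tmul,
      mor_act]
    rfl
  hexagon_forward X Y Z := by
    refine hom_ext (GVec.hom_ext (lin_ext₃ fun x v hv y w hw z t ht => ?_))
    have h := braidLin_apply (Y := tensorObj Y Z) hv (hw.tmul ht)
    change assocHom Y.obj Z.obj X.obj (braidLin X (tensorObj Y Z)
        (assocHom X.obj Y.obj Z.obj ((v ⊗ₜ w) ⊗ₜ t))) =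
      TensorProduct.map LinearMap.id (braidLin X Z) (assocHom Y.obj X.obj Z.obj
        (TensorProduct.map (braidLin X Y) LinearMap.id ((v ⊗ₜ w) ⊗ₜ t)))
    rw [assocHom_apply hv hw ht, TensorProduct.map_tmul, braidLin_apply hv hw,
      LinearMap.id_apply, ← TensorProduct.smul_tmul', map_smul, map_smul, map_smul,
      assocHom_apply hw (X.isHomog_act _ hv) ht, map_smul, map_smul, TensorProduct.map_tmul,
      braidLin_apply (X.isHomog_act _ hv) ht, X.act_act _ _ hv, LinearMap.id_apply,
      TensorProduct.tmul_smul, TensorProduct.tmul_smul, TensorProduct.tmul_smul]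
    refine (congrArg (fun q => ((D.assoc.val x y z : ℂˣ) : ℂ) • assocHom Y.obj Z.obj X.obj q)
      h).trans ?_
    rw [map_smul, assocHom_apply hw ht (X.isHomog_act _ hv), smul_smul, smul_smul, smul_smul,
      smul_smul, smul_smul, ← Units.val_mul, ← Units.val_mul, ← Units.val_mul, ← Units.val_mul,
      ← Units.val_mul, D.hexagon_forward, map_add]
  hexagon_reverse X Y Z := by
    refine hom_ext (GVec.hom_ext (lin_ext₃' fun x v hv y w hw z t ht => ?_))
    have h := braidLin_apply (X := tensorObj X Y) (hv.tmul hw) ht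
    have h' : (tensorObj X Y).act (D.deg z) (v ⊗ₜ w) = _ := tensorAct_apply X Y _ hv hw
    rw [h'] at h
    change assocInv Z.obj X.obj Y.obj (braidLin (tensorObj X Y) Z
        (assocInv X.obj Y.obj Z.obj (v ⊗ₜ (w ⊗ₜ t)))) =
      TensorProduct.map (braidLin X Z) LinearMap.id (assocInv X.obj Z.obj Y.obj
        (TensorProduct.map LinearMap.id (braidLin Y Z) (v ⊗ₜ (w ⊗ₜ t))))
    rw [assocInv_apply hv hw ht, TensorProduct.map_tmul, braidLin_apply hw ht,
      LinearMap.id_apply, TensorProduct.tmul_smul, map_smul, map_smul, map_smul,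
      assocInv_apply hv ht (Y.isHomog_act _ hw), map_smul, map_smul, TensorProduct.map_tmul,
      braidLin_apply hv ht, LinearMap.id_apply, ← TensorProduct.smul_tmul']
    refine (congrArg (fun q => (((D.assoc.val x y z)⁻¹ : ℂˣ) : ℂ) •
      assocInv Z.obj X.obj Y.obj q) h).trans ?_
    rw [map_smul, TensorProduct.tmul_smul, map_smul,
      assocInv_apply ht (X.isHomog_act _ hv) (Y.isHomog_act _ hw), smul_smul, smul_smul, smul_smul,
      smul_smul, smul_smul, ← Units.val_mul, ← Units.val_mul, ← Units.val_mul, ← Units.val_mul,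
      ← Units.val_mul]
    congr 2
    have e := D.hexagon_reverse x y z
    rw [← mul_assoc] at e
    exact e
end Equivariant

/-- A `ℂ`-linear braided monoidal equivalence exists. -/
def BraidedEquivalent (C D : Type*) [Category C] [Preadditive C] [Linear ℂ C]
    [MonoidalCategory C] [BraidedCategory C] [Category D] [Preadditive D] [Linear ℂ D]
    [MonoidalCategory D] [BraidedCategory D] : Prop :=
  ∃ F : C ⥤ D, F.IsEquivalence ∧ F.Additive ∧ F.Linear ℂ ∧ Nonempty F.Braided

/-- A bicharacter on `A`, i.e. the braiding of a pointed braided category with trivial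
associator and group of simple objects `A`. -/
structure Bicharacter (A : Type) [AddCommGroup A] where
  val : A → A → ℂˣ
  add_left : ∀ x y z, val (x + y) z = val x z * val y z
  add_right : ∀ x y z, val x (y + z) = val x y * val x z

section
variable {A : Type} [AddCommGroup A]

/-- The category of `A`-graded vector spaces with braiding `b`, graded by the trivial group. -/
def braidedVec (b : Bicharacter A) : StrictCrossed Unit A where
  deg := 0
  braid := b.val
  braid_add_left := b.add_left
  braid_add_right := b.add_right

/-- The trivial extension `G-Vect ⊠ B`, where `B` is the category of `A`-graded vector spaces with
braiding `b`: the grading is by the first factor, and the braiding is that of the second. -/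
def trivialExtension (G : Type) [AddCommGroup G] (b : Bicharacter A) :
    StrictCrossed G (G × A) where
  deg := AddMonoidHom.fst G A
  braid x y := b.val x.2 y.2
  braid_add_left x y z := b.add_left x.2 y.2 z.2
  braid_add_right x y z := b.add_right x.2 y.2 z.2

/-- `G-Vect` as a `G`-crossed braided extension of `Vect`. -/
def groupExtension (G : Type) [AddCommGroup G] : StrictCrossed G G where
  deg := AddMonoidHom.id G
  braid _ _ := 1
  braid_add_left _ _ _ := (mul_one 1).symm
  braid_add_right _ _ _ := (mul_one 1).symm

/-- The zesting datum with trivial `frac` and a given `3`-cocycle. -/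
def ZestingDatum.ofCocycle {G S : Type} [AddCommGroup G] [AddCommGroup S] (C : StrictCrossed G S)
    (ω : ThreeCocycle G) : ZestingDatum C where
  frac _ _ := 0
  deg_frac _ _ := map_zero C.deg
  frac_zero _ := rfl
  frac_comm _ _ := rfl
  frac_cocycle _ _ _ := rfl
  assoc := ω.val
  assoc_zero := ω.val_zero
  assoc_pentagon g h k l := by
    rw [ω.pentagon, ZestingDatum.braid_zero_left, mul_one]

/-- The trivial `3`-cocycle. -/
def ThreeCocycle.trivial (A : Type) [AddCommGroup A] : ThreeCocycle A where
  val _ _ _ := 1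
  val_zero _ _ := rfl
  pentagon _ _ _ _ := by simp
end

/-- The equivariantisation of a strict `G`-crossed braided category, with trivial `G`-action. -/
abbrev StrictEquivariant {G S : Type} [AddCommGroup G] [AddCommGroup S] [Fintype S]
    [DecidableEq S] (C : StrictCrossed G S) : Type 1 :=
  Equivariant (zest C (.ofCocycle C (.trivial G)))

/-- The category `(G-Vect^ω)^G`. -/
abbrev TwistedGauging {G : Type} [AddCommGroup G] [Fintype G] [DecidableEq G]
    (ω : ThreeCocycle G) : Type 1 :=
  Equivariant (zest (groupExtension G) (.ofCocycle _ ω))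

/-- The (twisted) double of `G`: the Drinfeld center of `G-Vect^ω`. -/
abbrev TwistedDouble {G : Type} [AddCommGroup G] [Fintype G] [DecidableEq G]
    (ω : ThreeCocycle G) : Type 1 :=
  Center (GVec ω)

theorem neg_one_pow_congr {a b : ℕ} (h : (a : ZMod 2) = b) : (-1 : ℂˣ) ^ a = (-1) ^ b := by
  rw [ZMod.natCast_eq_natCast_iff] at h
  have hs : (-1 : ℂˣ) ^ 2 = 1 := by simp
  rw [← Nat.div_add_mod a 2, ← Nat.div_add_mod b 2, pow_add, pow_add, pow_mul, pow_mul, hs,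
    one_pow, one_pow, show a % 2 = b % 2 from h]

theorem val_add_two (a b : ZMod 2) : (((a + b).val : ℕ) : ZMod 2) = a.val + b.val := by
  revert a b; decide

theorem val_add_four (a b : ZMod 4) : (((a + b).val : ℕ) : ZMod 2) = a.val + b.val := by
  revert a b; decide

/-- The `3`-cocycle `(k, l, m) ↦ (-1)^(klm)` on `ℤ/4`. -/
def signCocycle : ThreeCocycle (ZMod 4) where
  val k l m := (-1) ^ (k.val * l.val * m.val)
  val_zero k m := by simp
  pentagon k l m n := by
    rw [← pow_add, ← pow_add, ← pow_add]
    apply neg_one_pow_congr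
    push_cast [val_add_four]
    ring

/-- The braiding of `D(ℤ/2)`, with simple objects `m^a e^b` written as `(a, b)`: the braiding of
`m^a e^b` with `m^a' e^b'` is `(-1)^(b a')`. -/
def doubleZ2Braiding : Bicharacter (ZMod 2 × ZMod 2) where
  val x y := (-1) ^ (x.2.val * y.1.val)
  add_left x y z := by
    rw [← pow_add]
    apply neg_one_pow_congr
    push_cast [val_add_two, Prod.snd_add]
    ring
  add_right x y z := by
    rw [← pow_add]
    apply neg_one_pow_congr
    push_cast [val_add_two, Prod.fst_add]
    ring

/-- The zesting datum for `ℤ/2-Vect ⊠ D(ℤ/2)`: the fractionalisation is `m` at `(1, 1)` and the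
unit otherwise, the defectification is `p` at `(1, 1, 1)` and `1` otherwise. -/
def doubleZ2Zesting (p : ℤˣ) : ZestingDatum (trivialExtension (ZMod 2) doubleZ2Braiding) where
  frac g h := if g = 1 ∧ h = 1 then (0, (1, 0)) else 0
  deg_frac := by
    intro g h
    split_ifs <;> rfl
  frac_zero := by decide
  frac_comm := by decide
  frac_cocycle := by decide
  assoc g h k := if g = 1 ∧ h = 1 ∧ k = 1 then Units.map (Int.castRingHom ℂ).toMonoidHom p else 1
  assoc_zero g k := by simp
  assoc_pentagon g h k l := by
    have hb : (trivialExtension (ZMod 2) doubleZ2Braiding).braid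
        (if g = 1 ∧ h = 1 then (0, (1, 0)) else 0) (if k = 1 ∧ l = 1 then (0, (1, 0)) else 0) =
        1 := by
      split_ifs <;> simp [trivialExtension, doubleZ2Braiding]
    have hp : ∀ (p : ℤˣ) (g h k l : ZMod 2),
        (if g = 1 ∧ h = 1 ∧ k = 1 then p else 1) *
          (if g = 1 ∧ h + k = 1 ∧ l = 1 then p else 1) *
          (if h = 1 ∧ k = 1 ∧ l = 1 then p else 1) =
        (if g + h = 1 ∧ k = 1 ∧ l = 1 then p else 1) *
          (if g = 1 ∧ h = 1 ∧ k + l = 1 then p else 1) := by decide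
    rw [hb, mul_one]
    have e := congrArg (Units.map (Int.castRingHom ℂ).toMonoidHom) (hp p g h k l)
    simp only [map_mul, apply_ite (Units.map (Int.castRingHom ℂ).toMonoidHom), map_one] at e
    exact e

/-- The braided category obtained from `D(ℤ/2)` by gauging the `ℤ/2`-symmetry with
fractionalisation `m` and defectification `p`: the equivariantisation of the zesting of
`ℤ/2-Vect ⊠ D(ℤ/2)`. -/
abbrev GaugedDoubleZ2 (p : ℤˣ) : Type 1 :=
  Equivariant (zest (trivialExtension (ZMod 2) doubleZ2Braiding) (doubleZ2Zesting p))

end Gauging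

end

/-! An object of an equivariantisation is an `S`-graded vector space with an action of `G` that is
projective with multiplier the compositor. Part of the grading can be traded for part of the action:
a charge group is the same as an action of its character group. This is how the `e`-charge is
absorbed.

Zesting by `m` makes the simple objects `(g, m^a e^b)` into `ℤ/4 × ℤ/2`, since two objects of degree
`1` multiply to an extra `m`, and this `m` is the carry of the binary expansion `g + 2a`. The
compositor contains the double braiding with `m`, which is the sign `(-1)^b` when both group
elements are nontrivial. Hence `ℤ/2` acts only projectively on objects with `b = 1`, and the same
carry cocycle shows that, up to the factors coming from `ν`, this is an action of `ℤ/4` in which the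
element `2` acts by `(-1)^b`. Forgetting `b` therefore loses nothing: it is the eigenvalue of `2`.
Under this translation the braiding `(-1)^(b a')` becomes part of the action of `g' + 2a'`, so on
the `ℤ/4` side the crossed braiding is trivial, and `ν` becomes its pullback along `ℤ/4 → ℤ/2`: this
is `1` for `p = 1` and `(-1)^(kln)` for `p = -1`. The result is the equivariantisation of
`ℤ/4-Vect^ω`. The equivalence of `ℤ/2-Vect`'s double with the category of objects `m^a e^b` is the
same argument with trivial acting group on the fine side.

The exchange of grading for action is formalised by `Regrading`, a strictly monoidal braided
functor, and `Regrading.Separation`, the character orthogonality that makes it an equivalence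
(`Separation.braidedEquivalent`). The remaining ingredient, `braidedEquivalent_center`, says that
when the simple objects are graded by themselves and the crossed braiding is trivial, equivariant
structures are the same as half-braidings: the crossed hexagons force the compositor and the
tensorator to be the expressions in the associator that occur in the Drinfeld center. -/

noncomputable section

/-! ### Regradings and their braided functors -/

namespace Gauging

/-- A comparison of two pointed crossed braided categories: simple objects of the first are sent to
simple objects of the second by `obj`, the groups acting are related by `grp` in the other direction,
and the action of `g` on a vector of degree `x` is multiplied by `char g x`. -/
structure Regrading {G S G' S' : Type} [AddCommGroup G] [AddCommGroup S] [AddCommGroup G']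
    [AddCommGroup S'] (D : CrossedData G S) (D' : CrossedData G' S') where
  obj : S →+ S'
  grp : G' →+ G
  char : G' → S → ℂˣ
  char_add : ∀ g x y, char g (x + y) = char g x * char g y
  deg : ∀ x, grp (D'.deg (obj x)) = D.deg x
  assoc : ∀ x y z, D'.assoc.val (obj x) (obj y) (obj z) = D.assoc.val x y z
  tensorator : ∀ g x y, D'.tensorator g (obj x) (obj y) = D.tensorator (grp g) x y
  compositor : ∀ g h x, D'.compositor g h (obj x) * char (h + g) x =
    D.compositor (grp g) (grp h) x * (char g x * char h x)
  braid : ∀ x y, D'.braid (obj x) (obj y) * char (D'.deg (obj y)) x = D.braid x y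

namespace Regrading
open GVec Equivariant
variable {G S G' S' : Type} [AddCommGroup G] [AddCommGroup S] [AddCommGroup G']
  [AddCommGroup S'] {D : CrossedData G S} {D' : CrossedData G' S'} (R : Regrading D D')

theorem char_zero_right (g : G') : R.char g 0 = 1 := by
  simpa using R.char_add g 0 0

variable [Fintype S] [DecidableEq S] [Fintype S'] [DecidableEq S']

/-- The graded vector space with the coarser grading. -/
abbrev coarsen (X : GVec D.assoc) : GVec D'.assoc where
  carrier := X.carrier
  proj s := ∑ x, if R.obj x = s then X.proj x else 0
  proj_proj s t v := by
    suffices h : (∑ x, if R.obj x = s then X.proj x else 0) ∘ₗ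
        (∑ x, if R.obj x = t then X.proj x else 0) =
        if s = t then ∑ x, if R.obj x = t then X.proj x else 0 else 0 by
      have h' := LinearMap.congr_fun h v
      rw [LinearMap.comp_apply] at h'
      rw [h']; split_ifs <;> rfl
    refine lin_ext fun x v hv => ?_
    have key : ∀ s, (∑ x, if R.obj x = s then X.proj x else 0) v =
        if R.obj x = s then v else 0 := fun s => by
      rw [LinearMap.sum_apply, Finset.sum_eq_single x]
      · split_ifs <;> simp [hv.proj]
      · intro y _ hy
        split_ifs <;> simp [hv.proj, hy]
      · simp
    rw [LinearMap.comp_apply, key]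
    by_cases h1 : R.obj x = t <;> by_cases h2 : s = t <;> simp [h1, h2, key]; grind
  sum_proj v := by
    have h : ∀ s, (∑ x, if R.obj x = s then X.proj x else 0) v =
        ∑ x, if R.obj x = s then X.proj x v else 0 := fun s => by
      rw [LinearMap.sum_apply]
      exact Finset.sum_congr rfl fun x _ => by split_ifs <;> rfl
    simp only [h]
    rw [Finset.sum_comm]
    simp [X.sum_proj]

theorem isHomog_coarsen {X : GVec D.assoc} {x : S} {v : X.carrier} (hv : X.IsHomog x v) :
    (R.coarsen X).IsHomog (R.obj x) v := by
  change (∑ y, if R.obj y = R.obj x then X.proj y else 0) v = v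
  rw [LinearMap.sum_apply, Finset.sum_eq_single x]
  · simp [hv.proj]
  · intro y _ hy
    split_ifs <;> simp [hv.proj, hy]
  · simp

/-- A linear map that sends homogeneous vectors for the finer grading to homogeneous vectors. -/
def ofHomog {X : GVec D.assoc} {Y : GVec D'.assoc} (f : X.carrier →ₗ[ℂ] Y.carrier)
    (h : ∀ x v, X.IsHomog x v → Y.IsHomog (R.obj x) (f v)) : R.coarsen X ⟶ Y :=
  ofLin (X := R.coarsen X) f fun s v => by
    suffices h' : f ∘ₗ (R.coarsen X).proj s = Y.proj s ∘ₗ f from LinearMap.congr_fun h' v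
    refine lin_ext (X := X) fun x v hv => ?_
    rw [LinearMap.comp_apply, LinearMap.comp_apply, (R.isHomog_coarsen hv).proj, (h x v hv).proj]
    split_ifs <;> simp

/-- The automorphism of the coarser graded vector space that multiplies the component of degree `x`
by `f x`. -/
def scaleIso (X : GVec D.assoc) (f : S → ℂˣ) : R.coarsen X ≅ R.coarsen X where
  hom := R.ofHomog (Y := R.coarsen X) (scalar₁ X fun x => f x) fun x v hv => by
    rw [scalar₁_apply _ _ hv]; exact (R.isHomog_coarsen hv).smul _
  inv := R.ofHomog (Y := R.coarsen X) (scalar₁ X fun x => ((f x)⁻¹ : ℂˣ)) fun x v hv => by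
    rw [scalar₁_apply _ _ hv]; exact (R.isHomog_coarsen hv).smul _
  hom_inv_id := by
    refine GVec.hom_ext (lin_ext (X := X) fun x v hv => ?_)
    change scalar₁ X _ (scalar₁ X _ v) = v
    simp [scalar₁_apply _ _ hv]
  inv_hom_id := by
    refine GVec.hom_ext (lin_ext (X := X) fun x v hv => ?_)
    change scalar₁ X _ (scalar₁ X _ v) = v
    simp [scalar₁_apply _ _ hv]

/-- Coarsening the grading is functorial. -/
def coarsenHom {X Y : GVec D.assoc} (f : X ⟶ Y) : R.coarsen X ⟶ R.coarsen Y :=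
  R.ofHomog (Y := R.coarsen Y) (lin f) fun _ _ hv => R.isHomog_coarsen (hv.map f)

/-- Coarsening the grading on isomorphisms. -/
def coarsenIso {X Y : GVec D.assoc} (e : X ≅ Y) : R.coarsen X ≅ R.coarsen Y where
  hom := R.coarsenHom e.hom
  inv := R.coarsenHom e.inv
  hom_inv_id := GVec.hom_ext (congrArg lin e.hom_inv_id :)
  inv_hom_id := GVec.hom_ext (congrArg lin e.inv_hom_id :)

/-- The equivariant object with the coarser grading and the rescaled action. -/
abbrev objMap (X : Equivariant D) : Equivariant D' where
  obj := R.coarsen X.obj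
  u g := R.scaleIso X.obj (R.char g) ≪≫ R.coarsenIso (X.u (R.grp g))
  u_comp g h := by
    refine GVec.hom_ext (lin_ext (X := X.obj) fun x v hv => ?_)
    change X.act (R.grp g) (scalar₁ X.obj _ (X.act (R.grp h) (scalar₁ X.obj _ v))) =
      X.act (R.grp (h + g)) (scalar₁ X.obj _ (scalar₁ (R.coarsen X.obj) _ v))
    rw [scalar₁_apply _ _ (R.isHomog_coarsen hv)]
    -- Multiplying the action by `char` changes its multiplier by the coboundary of `char` in the
    -- group variable; this field says that the result is the multiplier required by `D'`.
    have e := R.compositor g h x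
    simp only [map_smul, scalar₁_apply _ _ hv, scalar₁_apply _ _ (X.isHomog_act _ hv),
      X.act_act _ _ hv, smul_smul, map_add, ← Units.val_mul]
    rw [e, mul_comm (R.char g x), mul_comm _ (D.compositor _ _ _)]

theorem act_objMap (X : Equivariant D) (g : G') {x : S} {v : X.obj.carrier}
    (hv : X.obj.IsHomog x v) :
    (R.objMap X).act g v = (R.char g x : ℂ) • X.act (R.grp g) v := by
  change X.act (R.grp g) (scalar₁ X.obj _ v) = _
  rw [scalar₁_apply _ _ hv, map_smul]

/-- An equivariant morphism given by an underlying isomorphism. -/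
def objIso {X : Equivariant D} {Y : Equivariant D'} (e : X.obj.carrier ≃ₗ[ℂ] Y.obj.carrier)
    (h : ∀ x v, X.obj.IsHomog x v → Y.obj.IsHomog (R.obj x) (e v))
    (ha : ∀ g x v, X.obj.IsHomog x v → (R.char g x : ℂ) • e (X.act (R.grp g) v) = Y.act g (e v)) :
    R.objMap X ≅ Y :=
  ofIso (X := R.objMap X) (isoOfEquiv (X := R.coarsen X.obj) e (R.ofHomog e.toLinearMap h).2)
    fun g => GVec.hom_ext (lin_ext (X := X.obj) fun x v hv => by
      change e ((R.objMap X).act g v) = Y.act g (e v)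
      rw [R.act_objMap _ _ hv, map_smul, ha g x v hv])

/-- The functor that coarsens the grading and rescales the action. -/
def functor : Equivariant D ⥤ Equivariant D' where
  obj := R.objMap
  map {X Y} f := ofMor (X := R.objMap X) (Y := R.objMap Y) (R.coarsenHom (mor f)) fun g => by
    refine GVec.hom_ext (lin_ext (X := X.obj) fun x v hv => ?_)
    change lin (mor f) ((R.objMap X).act g v) = (R.objMap Y).act g (lin (mor f) v)
    rw [R.act_objMap _ _ hv, R.act_objMap _ _ (hv.map _), map_smul, mor_act]
  map_id _ := rfl
  map_comp _ _ := rfl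

instance : R.functor.Additive where
  map_add := rfl

instance : R.functor.Linear ℂ where
  map_smul _ _ := rfl

theorem isHomog_tensor {X Y : Equivariant D} {x y : S} {v : X.obj.carrier} {w : Y.obj.carrier}
    (hv : X.obj.IsHomog x v) (hw : Y.obj.IsHomog y w) :
    (GVec.tensorObj (R.coarsen X.obj) (R.coarsen Y.obj)).IsHomog (R.obj (x + y)) (v ⊗ₜ w) := by
  rw [map_add]; exact (R.isHomog_coarsen hv).tmul (R.isHomog_coarsen hw)

/-- Multiplicativity of `char` in the simple object lets the rescaling factors of the two tensor
factors combine, and the tensorators agree. Hence the identity map is equivariant, and the functor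
can be strictly monoidal. -/
theorem act_tensor_objMap (X Y : Equivariant D) (g : G') {x : S} {v : X.obj.carrier}
    (hv : X.obj.IsHomog x v) {y : S} {w : Y.obj.carrier} (hw : Y.obj.IsHomog y w) :
    (Equivariant.tensorObj (R.objMap X) (R.objMap Y)).act g (v ⊗ₜ w) =
      (R.objMap (Equivariant.tensorObj X Y)).act g (v ⊗ₜ w) := by
  have h1 := tensorAct_apply (R.objMap X) (R.objMap Y) g (R.isHomog_coarsen hv)
    (R.isHomog_coarsen hw)
  have h2 := R.act_objMap (Equivariant.tensorObj X Y) g (hv.tmul hw)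
  have h3 := tensorAct_apply X Y (R.grp g) hv hw
  refine Eq.trans h1 (Eq.trans ?_ (h2.trans (congrArg _ h3)).symm)
  rw [R.act_objMap _ _ hv, R.act_objMap _ _ hw, TensorProduct.smul_tmul_smul, smul_smul, smul_smul,
    R.char_add, R.tensorator]
  congr 1
  push_cast; ring

/-- The functor preserves tensor products strictly. -/
def tensorIso (X Y : Equivariant D) :
    Equivariant.tensorObj (R.objMap X) (R.objMap Y) ≅ R.objMap (Equivariant.tensorObj X Y) :=
  (ofIso (X := R.objMap (Equivariant.tensorObj X Y))
    (Y := Equivariant.tensorObj (R.objMap X) (R.objMap Y))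
    (isoOfEquiv (X := R.coarsen (GVec.tensorObj X.obj Y.obj))
      (Y := GVec.tensorObj (R.coarsen X.obj) (R.coarsen Y.obj)) (LinearEquiv.refl ℂ _)
      (fun s v => by
        -- Coarsening before or after tensoring yields the same grading because `R.obj` is additive,
        -- but the projections are written as different sums, so they are compared on bihomogeneous
        -- vectors.
        suffices h : (R.coarsen (GVec.tensorObj X.obj Y.obj)).proj s =
          (GVec.tensorObj (R.coarsen X.obj) (R.coarsen Y.obj)).proj s from LinearMap.congr_fun h v
        refine lin_ext₂ fun x v hv y w hw => ?_
        rw [(R.isHomog_coarsen (hv.tmul hw)).proj]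
        exact ((R.isHomog_tensor hv hw).proj s).symm))
    fun g => GVec.hom_ext (lin_ext₂ (X := X.obj) (Y := Y.obj) fun x v hv y w hw =>
      (R.act_tensor_objMap X Y g hv hw).symm)).symm

/-- The functor preserves the unit strictly. -/
def unitIso : Equivariant.tensorUnit D' ≅ R.objMap (Equivariant.tensorUnit D) :=
  (R.objIso (X := Equivariant.tensorUnit D) (Y := Equivariant.tensorUnit D') (LinearEquiv.refl ℂ _)
    (fun x v hv => by
      by_cases hx : x = 0
      · subst hx; rw [map_zero]; exact isHomog_unit _
      · have : v = 0 := by simpa [IsHomog, hx] using hv.symm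
        subst this; exact map_zero _)
    (fun g x v hv => by
      by_cases hx : x = 0
      · subst hx; rw [R.char_zero_right, Units.val_one, one_smul]; rfl
      · have : v = 0 := by simpa [IsHomog, hx] using hv.symm
        subst this; simp)).symm

/-- The functor is monoidal. -/
def coreMonoidal : R.functor.CoreMonoidal where
  εIso := R.unitIso
  μIso := R.tensorIso
  μIso_hom_natural_left f X' :=
    Equivariant.hom_ext (GVec.hom_ext (TensorProduct.ext' fun v w => rfl))
  μIso_hom_natural_right X' f :=
    Equivariant.hom_ext (GVec.hom_ext (TensorProduct.ext' fun v w => rfl))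
  associativity X Y Z := by
    refine Equivariant.hom_ext (GVec.hom_ext ?_)
    refine lin_ext₃ (X := X.obj) (Y := Y.obj) (Z := Z.obj) fun x v hv y w hw z t ht => ?_
    change assocHom X.obj Y.obj Z.obj ((v ⊗ₜ w) ⊗ₜ t) = TensorProduct.map LinearMap.id
      LinearMap.id (assocHom (R.coarsen X.obj) (R.coarsen Y.obj) (R.coarsen Z.obj) ((v ⊗ₜ w) ⊗ₜ t))
    rw [assocHom_apply hv hw ht, assocHom_apply (R.isHomog_coarsen hv) (R.isHomog_coarsen hw)
      (R.isHomog_coarsen ht), R.assoc, map_smul]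
    rfl
  left_unitality X := by
    refine Equivariant.hom_ext (GVec.hom_ext ?_)
    exact TensorProduct.ext' fun c v => rfl
  right_unitality X := by
    refine Equivariant.hom_ext (GVec.hom_ext ?_)
    exact TensorProduct.ext' fun c v => rfl

instance : R.functor.Monoidal := R.coreMonoidal.toMonoidal

/-- In the target the first factor is moved by the rescaled action of the coarse degree of the
second. The rescaling contributes a factor `char`, and `R.braid` says that this is exactly the
discrepancy between the two crossed braidings. -/
instance : R.functor.Braided where
  braided X Y := by
    refine Equivariant.hom_ext (GVec.hom_ext ?_)
    refine lin_ext₂ (X := X.obj) (Y := Y.obj) fun x v hv y w hw => ?_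
    change braidLin X Y (v ⊗ₜ w) = braidLin (R.objMap X) (R.objMap Y) (v ⊗ₜ w)
    rw [braidLin_apply hv hw]
    refine Eq.trans ?_ (braidLin_apply (X := R.objMap X) (Y := R.objMap Y)
      (R.isHomog_coarsen hv) (R.isHomog_coarsen hw)).symm
    rw [R.act_objMap _ _ hv, R.deg, TensorProduct.tmul_smul, smul_smul, ← Units.val_mul, R.braid]

end Regrading
end Gauging

/-! ### When a regrading is an equivalence: recovering the fine grading from the kernel -/

namespace Gauging
namespace Equivariant
open GVec
variable {G S : Type} [AddCommGroup G] [AddCommGroup S] [Fintype S] [DecidableEq S]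
  {D : CrossedData G S}

/-- The compositor is trivial at the neutral element, so this operator is idempotent; being
invertible, it is the identity. -/
theorem act_zero (X : Equivariant D) (v : X.obj.carrier) : X.act 0 v = v := by
  suffices h : X.act 0 = LinearMap.id from LinearMap.congr_fun h v
  refine lin_ext fun x v hv => ?_
  have h := X.act_act 0 0 hv
  rw [D.compositor_id_left, Units.val_one, one_smul, add_zero] at h
  simpa only [inv_act, LinearMap.id_apply] using congrArg (lin (X.u 0).inv) h

/-- The linear equivalence underlying `u g`. -/
def actEquiv (X : Equivariant D) (g : G) : X.obj.carrier ≃ₗ[ℂ] X.obj.carrier :=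
  LinearEquiv.ofLinearMap (X.act g) (lin (X.u g).inv) (LinearMap.ext (X.act_inv g))
    (LinearMap.ext (X.inv_act g))

end Equivariant

namespace Regrading
open GVec Equivariant
variable {G S G' S' : Type} [AddCommGroup G] [AddCommGroup S] [AddCommGroup G']
  [AddCommGroup S'] {D : CrossedData G S} {D' : CrossedData G' S'} (R : Regrading D D')
  [Fintype S] [DecidableEq S] [Fintype S'] [DecidableEq S']

/-- The kernel `K` of the map of groups separates the simple objects with the same image: the scalars
by which `K` acts on the fibres of the map of simple objects satisfy the orthogonality relations. -/
structure Separation (K : Type) [AddCommGroup K] [Fintype K] [DecidableEq K] where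
  incl : K →+ G'
  grp_incl : ∀ k, R.grp (incl k) = 0
  exact : ∀ a b, R.grp a = R.grp b → ∃ k, a = incl k + b
  surjective : Function.Surjective R.grp
  sum_char : ∀ x y, R.obj x = R.obj y → x ≠ y →
    ∑ k, (R.char (incl k) x : ℂ)⁻¹ * R.char (incl k) y = 0
  sum_fibre : ∀ s k, (∑ x, if R.obj x = s then (R.char (incl k) x : ℂ)⁻¹ else 0) =
    if k = 0 then (Fintype.card K : ℂ) else 0

instance : R.functor.Faithful where
  map_injective h := Equivariant.hom_ext (GVec.hom_ext (congrArg (fun f => lin (mor f)) h :))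

namespace Separation
variable {R} {K : Type} [AddCommGroup K] [Fintype K] [DecidableEq K] (T : Separation R K)
include T

/-- On the image of the functor, the kernel acts on the component of fine degree `x` by the scalars
`char (incl k) x`. A morphism commutes with this action, and distinct degrees in one fibre have
distinct scalars, so it preserves the fine grading. -/
theorem full : R.functor.Full where
  map_surjective {X Y} f := by
    let f' : R.objMap X ⟶ R.objMap Y := f
    let φ : X.obj.carrier →ₗ[ℂ] Y.obj.carrier := (lin (mor f') :)
    have hact : ∀ g v, φ ((R.objMap X).act g v) = (R.objMap Y).act g (φ v) := fun g v =>
      mor_act f' g v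
    have hY : ∀ g w, (R.objMap Y).act g w =
        ∑ y, (R.char g y : ℂ) • Y.act (R.grp g) (Y.obj.proj y w) := by
      intro g w
      conv_lhs => rw [← Y.obj.sum_proj w]
      refine (map_sum ((R.objMap Y).act g) _ _).trans (Finset.sum_congr rfl fun y _ => ?_)
      exact R.act_objMap Y g (Y.obj.isHomog_proj y w)
    have hhom : ∀ x v, X.obj.IsHomog x v → Y.obj.IsHomog x (φ v) := by
      intro x v hv
      suffices h : ∀ y, y ≠ x → Y.obj.proj y (φ v) = 0 by
        have e := Y.obj.sum_proj (φ v)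
        rwa [Finset.sum_eq_single x (fun y _ hy => h y hy) (by simp)] at e
      intro y hy
      by_contra hne
      have hcoarse : (R.coarsen Y.obj).IsHomog (R.obj x) (φ v) :=
        (R.isHomog_coarsen hv).map (mor f')
      -- A nonzero `y`-component forces `y` into the fibre of `x`, as the coarse degree is preserved
      -- by assumption.
      have hxy : R.obj x = R.obj y := by
        by_contra hxy
        apply hne
        rw [← hcoarse]
        change Y.obj.proj y ((∑ z, if R.obj z = R.obj x then Y.obj.proj z else 0) (φ v)) = 0
        rw [LinearMap.sum_apply, map_sum]
        refine Finset.sum_eq_zero fun z _ => ?_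
        split_ifs with hz
        · rw [Y.obj.proj_proj, if_neg]
          rintro rfl
          exact hxy hz.symm
        · simp
      -- The nonzero `y`-component of `φ v` is multiplied by both scalars, since `incl k` maps to
      -- `0` and `act 0` is the identity.
      have hchar : ∀ k, R.char (T.incl k) x = R.char (T.incl k) y := by
        intro k
        have e := hact (T.incl k) v
        rw [R.act_objMap _ _ hv, T.grp_incl, act_zero, hY, T.grp_incl] at e
        have e' := congrArg (Y.obj.proj y) e
        simp only [act_zero, map_smul, map_sum, Y.obj.proj_proj] at e'
        rw [Finset.sum_eq_single y (by intro z _ hz; simp [hz.symm]) (by simp), if_pos rfl] at e'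
        exact Units.ext (smul_left_injective ℂ hne e')
      -- If all scalars agreed, this sum would be the order of `K`, which is nonzero in `ℂ`.
      have e := T.sum_char x y hxy hy.symm
      simp [hchar] at e
    refine ⟨ofMor (ofLin φ (comm_of_isHomog φ hhom)) fun g => ?_,
      Equivariant.hom_ext (GVec.hom_ext rfl)⟩
    refine GVec.hom_ext (lin_ext fun x v hv => ?_)
    -- Compatibility with `g` is read off from any preimage `a`: source and target have the same
    -- fine degree, so the factors `char a x` cancel.
    obtain ⟨a, rfl⟩ := T.surjective g
    have e := hact a v
    rw [R.act_objMap _ _ hv, R.act_objMap _ _ (hhom x v hv), map_smul] at e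
    exact (smul_right_injective _ (R.char a x).ne_zero) e

variable (Y : Equivariant D')

/-- The projection to the vectors of degree `x`: those of degree `R.obj x` on which the kernel acts
by the scalars determined by `x`. -/
def fineProj (x : S) : Y.obj.carrier →ₗ[ℂ] Y.obj.carrier :=
  (Fintype.card K : ℂ)⁻¹ • ∑ k, (R.char (T.incl k) x : ℂ)⁻¹ • Y.act (T.incl k) ∘ₗ
    Y.obj.proj (R.obj x)

omit [DecidableEq S] in
theorem fineProj_apply {s : S'} {v : Y.obj.carrier} (hv : Y.obj.IsHomog s v) (x : S) :
    T.fineProj Y x v = if R.obj x = s then (Fintype.card K : ℂ)⁻¹ •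
      ∑ k, (R.char (T.incl k) x : ℂ)⁻¹ • Y.act (T.incl k) v else 0 := by
  simp only [fineProj, LinearMap.smul_apply, LinearMap.sum_apply, LinearMap.comp_apply, hv.proj]
  split_ifs <;> simp

omit [DecidableEq S] in
theorem isHomog_fineProj (x : S) (v : Y.obj.carrier) :
    Y.obj.IsHomog (R.obj x) (T.fineProj Y x v) := by
  simp only [fineProj, LinearMap.smul_apply, LinearMap.sum_apply, LinearMap.comp_apply]
  refine IsHomog.smul ?_ _
  rw [IsHomog, map_sum]
  exact Finset.sum_congr rfl fun k _ => (Y.isHomog_act _ (Y.obj.isHomog_proj _ _)).smul _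

omit [DecidableEq S] in
-- The usual computation with an averaging projector, by the shift `k ↦ k + m`. The action of `K` on
-- `Y` may be projective, but on degree `R.obj x` its multiplier is the coboundary of `char · x`,
-- because the compositor of `D` is trivial on the kernel; so `char · x` plays the role of a
-- character.
theorem act_incl_fineProj (m : K) (x : S) (v : Y.obj.carrier) :
    Y.act (T.incl m) (T.fineProj Y x v) = (R.char (T.incl m) x : ℂ) • T.fineProj Y x v := by
  simp only [fineProj, LinearMap.smul_apply, LinearMap.sum_apply, LinearMap.comp_apply, map_smul,
    map_sum]
  rw [smul_comm]
  congr 1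
  rw [Finset.smul_sum]
  -- Only the right-hand sum is reindexed, so that its terms at `k + m` match those produced by
  -- composing the two actions.
  refine Eq.trans ?_ (Equiv.sum_comp (Equiv.addRight m) _)
  refine Finset.sum_congr rfl fun k _ => ?_
  rw [Y.act_act _ _ (Y.obj.isHomog_proj _ _), smul_smul, smul_smul, Equiv.coe_addRight, map_add]
  congr 1
  have e := congrArg Units.val (R.compositor (T.incl m) (T.incl k) x)
  rw [T.grp_incl, T.grp_incl, D.compositor_id_left, one_mul] at e
  push_cast at e
  have h1 := (R.char (T.incl k) x).ne_zero
  have h2 := (R.char (T.incl k + T.incl m) x).ne_zero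
  field_simp
  linear_combination e

omit [DecidableEq S] in
-- The kernel commutes with the whole action on degrees in the image of `R.obj`, so every operator
-- `act a` preserves the fine grading.
theorem act_fineProj (a : G') (x : S) (v : Y.obj.carrier) :
    Y.act a (T.fineProj Y x v) = T.fineProj Y x (Y.act a v) := by
  suffices h : Y.act a ∘ₗ T.fineProj Y x = T.fineProj Y x ∘ₗ Y.act a from LinearMap.congr_fun h v
  refine lin_ext fun s v hv => ?_
  rw [LinearMap.comp_apply, LinearMap.comp_apply, T.fineProj_apply Y hv,
    T.fineProj_apply Y (Y.isHomog_act a hv)]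
  split_ifs with hs
  · rw [map_smul, map_sum]
    congr 1
    refine Finset.sum_congr rfl fun k _ => ?_
    rw [map_smul, Y.act_act _ _ hv, Y.act_act _ _ hv, add_comm a, ← hs]
    have e1 := R.compositor (T.incl k) a x
    have e2 := R.compositor a (T.incl k) x
    rw [T.grp_incl, D.compositor_id_left] at e1
    rw [T.grp_incl, D.compositor_id_right] at e2
    -- In both orders the compositor equals `char a x * char (incl k) x / char (incl k + a) x`,
    -- because `D` contributes nothing when one argument is `0`.
    have e : D'.compositor a (T.incl k) (R.obj x) = D'.compositor (T.incl k) a (R.obj x) := by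
      apply mul_right_cancel (b := R.char (T.incl k + a) x)
      rw [e2, add_comm, e1, mul_comm (R.char a x)]
    rw [e]
  · simp

/-- The object with the finer grading. -/
abbrev refine : GVec D.assoc where
  carrier := Y.obj.carrier
  proj := T.fineProj Y
  proj_proj x y v := by
    -- `K` acts on the image of the projector for `y` by scalars, so averaging against `x` becomes a
    -- character sum: it is `|K|` for `x = y` and vanishes by `sum_char` for other `x` in the same
    -- fibre.
    suffices h : T.fineProj Y x (T.fineProj Y y v) = if R.obj x = R.obj y then
        ((Fintype.card K : ℂ)⁻¹ * ∑ k, (R.char (T.incl k) x : ℂ)⁻¹ * R.char (T.incl k) y) •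
          T.fineProj Y y v else 0 by
      rw [h]
      by_cases hxy : x = y
      · subst hxy
        simp
      · rw [if_neg hxy]
        split_ifs with h'
        · rw [T.sum_char x y h' hxy, mul_zero, zero_smul]
        · rfl
    rw [T.fineProj_apply Y (T.isHomog_fineProj Y y v)]
    refine if_congr Iff.rfl ?_ rfl
    rw [mul_smul, Finset.sum_smul]
    simp only [act_incl_fineProj, smul_smul]
  sum_proj v := by
    suffices h : ∑ x, T.fineProj Y x = LinearMap.id by
      have h' := LinearMap.congr_fun h v
      rwa [LinearMap.sum_apply] at h'
    refine lin_ext fun s v hv => ?_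
    rw [LinearMap.sum_apply]
    have h : ∀ x, T.fineProj Y x v = (Fintype.card K : ℂ)⁻¹ •
        ∑ k, (if R.obj x = s then (R.char (T.incl k) x : ℂ)⁻¹ else 0) •
          Y.act (T.incl k) v := fun x => by
      rw [T.fineProj_apply Y hv]
      split_ifs <;> simp
    -- After exchanging the sums, the inner one runs over a fibre of `R.obj`; by `sum_fibre` only `k
    -- = 0` survives, with the factor `|K|` that cancels the normalisation.
    rw [Finset.sum_congr rfl fun x _ => h x, ← Finset.smul_sum, Finset.sum_comm]
    simp_rw [← Finset.sum_smul, T.sum_fibre]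
    simp [ite_smul, act_zero]

variable {Y}

theorem coarse_isHomog {x : S} {v : Y.obj.carrier} (hv : (T.refine Y).IsHomog x v) :
    Y.obj.IsHomog (R.obj x) v := by
  have h := T.isHomog_fineProj Y x v
  rwa [show T.fineProj Y x v = v from hv] at h

/-- Two preimages of one element of `G` differ by some `k` in the kernel, which acts on fine degree
`x` by `char (incl k) x`; the relation between `char` and the compositor absorbs the rest. Undoing
the rescaling thus gives a well-defined action of `G`. -/
theorem act_congr {a b : G'} (h : R.grp a = R.grp b) {x : S} {v : Y.obj.carrier}
    (hv : (T.refine Y).IsHomog x v) :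
    (R.char a x : ℂ)⁻¹ • Y.act a v = (R.char b x : ℂ)⁻¹ • Y.act b v := by
  obtain ⟨k, rfl⟩ := T.exact a b h
  have h1 := Y.act_act b (T.incl k) (T.coarse_isHomog hv)
  have h2 := T.act_incl_fineProj Y k x v
  rw [show T.fineProj Y x v = v from hv] at h2
  rw [h2, map_smul] at h1
  have e := congrArg Units.val (R.compositor b (T.incl k) x)
  rw [T.grp_incl, D.compositor_id_right, one_mul] at e
  push_cast at e
  have n1 := (R.char (T.incl k) x).ne_zero
  have n2 := (R.char (T.incl k + b) x).ne_zero
  have n3 := (R.char b x).ne_zero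
  have n4 := (D'.compositor b (T.incl k) (R.obj x)).ne_zero
  rw [← inv_smul_smul₀ n4 (Y.act (T.incl k + b) v), ← h1, smul_smul, smul_smul]
  congr 1
  field_simp
  linear_combination -e

variable (Y)

/-- The action on the object with the finer grading. -/
def liftIso (g : G) : T.refine Y ≅ T.refine Y :=
  (scalarIso (T.refine Y) (R.char (Function.surjInv T.surjective g))).symm ≪≫
    isoOfEquiv (X := T.refine Y) (Y := T.refine Y)
      (Y.actEquiv (Function.surjInv T.surjective g)) (T.act_fineProj Y _)

/-- Replaces the chosen preimage of `g`, which is not additive in `g`, by any convenient one. -/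
theorem liftIso_apply (g : G) (a : G') (h : R.grp a = g) {x : S} {v : Y.obj.carrier}
    (hv : (T.refine Y).IsHomog x v) :
    lin (T.liftIso Y g).hom v = (R.char a x : ℂ)⁻¹ • Y.act a v := by
  rw [T.act_congr (h.trans (Function.surjInv_eq T.surjective g).symm) hv]
  change Y.act _ (scalar₁ (T.refine Y) _ v) = _
  rw [scalar₁_apply _ _ hv, map_smul, Units.val_inv_eq_inv_val]

/-- The equivariant object with the finer grading. -/
abbrev lift : Equivariant D where
  obj := T.refine Y
  u := T.liftIso Y
  u_comp g h := by
    refine GVec.hom_ext (lin_ext fun x v hv => ?_)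
    -- With preimages `a` and `b` of the two elements, `b + a` can serve as the preimage of their
    -- sum, and the claim reduces to `R.compositor`.
    obtain ⟨a, rfl⟩ := T.surjective g
    obtain ⟨b, rfl⟩ := T.surjective h
    change lin (T.liftIso Y _).hom (lin (T.liftIso Y _).hom v) =
      lin (T.liftIso Y _).hom (scalar₁ (T.refine Y) _ v)
    rw [T.liftIso_apply Y _ a rfl (hv.map _), T.liftIso_apply Y _ b rfl hv,
      scalar₁_apply _ _ hv, map_smul, map_smul, T.liftIso_apply Y _ (b + a) (map_add _ _ _) hv,
      Y.act_act _ _ (T.coarse_isHomog hv), smul_smul, smul_smul, smul_smul]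
    congr 1
    have e := congrArg Units.val (R.compositor a b x)
    push_cast at e
    have n1 := (R.char a x).ne_zero
    have n2 := (R.char (b + a) x).ne_zero
    have n3 := (R.char b x).ne_zero
    field_simp
    linear_combination e

/-- Refining and then coarsening changes neither the space nor, after the two rescalings cancel, the
action, so the identity map is the required isomorphism. -/
theorem essSurj : R.functor.EssSurj where
  mem_essImage Y := ⟨T.lift Y, ⟨R.objIso (X := T.lift Y) (LinearEquiv.refl ℂ _)
    (fun x v hv => T.coarse_isHomog hv) fun g x v hv => by
      have h : (T.lift Y).act (R.grp g) v = _ := T.liftIso_apply Y _ g rfl hv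
      rw [LinearEquiv.refl_apply, LinearEquiv.refl_apply, h, smul_inv_smul₀ (Units.ne_zero _)]⟩⟩

theorem braidedEquivalent : BraidedEquivalent (Equivariant D) (Equivariant D') :=
  ⟨R.functor, { full := T.full, essSurj := T.essSurj }, inferInstance, inferInstance,
    ⟨inferInstance⟩⟩

end Separation
end Regrading
end Gauging

/-! ### From equivariant objects to the Drinfeld center -/

namespace Gauging
open GVec
variable {G : Type} [AddCommGroup G] [Fintype G] [DecidableEq G] {D : CrossedData G G}

namespace Equivariant

/-- The half-braiding of an equivariant object with a graded vector space: on vectors of degrees `x`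
and `y` it is `v ⊗ w ↦ w ⊗ u y v`. -/
def halfBraidLin (X : Equivariant D) (U : GVec D.assoc) : X.obj.carrier ⊗[ℂ] U.carrier →ₗ[ℂ]
    U.carrier ⊗[ℂ] X.obj.carrier :=
  ∑ y, TensorProduct.map (U.proj y) (X.act y) ∘ₗ
    (TensorProduct.comm ℂ X.obj.carrier U.carrier).toLinearMap

/-- The inverse of `halfBraidLin`. -/
def halfBraidInvLin (X : Equivariant D) (U : GVec D.assoc) : U.carrier ⊗[ℂ] X.obj.carrier →ₗ[ℂ]
    X.obj.carrier ⊗[ℂ] U.carrier :=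
  ∑ y, TensorProduct.map (lin (X.u y).inv) (U.proj y) ∘ₗ
    (TensorProduct.comm ℂ U.carrier X.obj.carrier).toLinearMap

theorem halfBraidLin_apply (X : Equivariant D) (U : GVec D.assoc) (v : X.obj.carrier) {y : G}
    {w : U.carrier} (hw : U.IsHomog y w) : halfBraidLin X U (v ⊗ₜ w) = w ⊗ₜ X.act y v := by
  simp only [halfBraidLin, LinearMap.sum_apply, LinearMap.comp_apply,
    LinearEquiv.coe_coe, TensorProduct.comm_tmul, TensorProduct.map_tmul, hw.proj]
  rw [Finset.sum_eq_single y] <;> simp +contextual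

theorem halfBraidInvLin_apply (X : Equivariant D) (U : GVec D.assoc) (v : X.obj.carrier) {y : G}
    {w : U.carrier} (hw : U.IsHomog y w) :
    halfBraidInvLin X U (w ⊗ₜ v) = lin (X.u y).inv v ⊗ₜ w := by
  simp only [halfBraidInvLin, LinearMap.sum_apply, LinearMap.comp_apply,
    LinearEquiv.coe_coe, TensorProduct.comm_tmul, TensorProduct.map_tmul, hw.proj]
  rw [Finset.sum_eq_single y] <;> simp +contextual

/-- The components of the half-braiding. -/
def halfBraidIso (X : Equivariant D) (U : GVec D.assoc) : X.obj ⊗ U ≅ U ⊗ X.obj where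
  hom := ofLin (X := GVec.tensorObj X.obj U) (Y := GVec.tensorObj U X.obj)
    (halfBraidLin X U) (comm_of_isHomog₂ (Z := GVec.tensorObj U X.obj) _ fun x v hv y w hw => by
      rw [halfBraidLin_apply _ _ _ hw, add_comm]
      exact hw.tmul (X.isHomog_act _ hv))
  inv := ofLin (X := GVec.tensorObj U X.obj) (Y := GVec.tensorObj X.obj U)
    (halfBraidInvLin X U) (comm_of_isHomog₂ (Z := GVec.tensorObj X.obj U) _
      fun y w hw x v hv => by
        rw [halfBraidInvLin_apply _ _ _ hw, add_comm]
        exact (hv.map _).tmul hw)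
  hom_inv_id := by
    refine GVec.hom_ext (lin_ext₂ fun x v hv y w hw => ?_)
    change halfBraidInvLin X U (halfBraidLin X U (v ⊗ₜ w)) = v ⊗ₜ w
    rw [halfBraidLin_apply _ _ _ hw, halfBraidInvLin_apply _ _ _ hw, inv_act]
  inv_hom_id := by
    refine GVec.hom_ext (lin_ext₂ fun y w hw x v hv => ?_)
    change halfBraidLin X U (halfBraidInvLin X U (w ⊗ₜ v)) = w ⊗ₜ v
    rw [halfBraidInvLin_apply _ _ _ hw, halfBraidLin_apply _ _ _ hw, act_inv]

end Equivariant

/-- The forward crossed hexagon with trivial braiding. It forces the compositor to be the slant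
product of the associator, the multiplier that appears in the hexagon of a half-braiding. -/
theorem CrossedData.compositor_eq {G : Type} [AddCommGroup G] {D : CrossedData G G}
    (hdeg : ∀ x, D.deg x = x) (hbraid : ∀ x y, D.braid x y = 1) (x y z : G) :
    D.assoc.val x y z * D.assoc.val y z x = D.assoc.val y x z * D.compositor z y x := by
  have h := D.hexagon_forward x y z
  simpa only [hbraid, hdeg, mul_one, one_mul] using h

/-- The reverse crossed hexagon with trivial braiding. It forces the tensorator to be the product of
associators that appears in the half-braiding of a tensor product in the center. -/
theorem CrossedData.tensorator_eq {G : Type} [AddCommGroup G] {D : CrossedData G G}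
    (hdeg : ∀ x, D.deg x = x) (hbraid : ∀ x y, D.braid x y = 1) (x y z : G) :
    D.assoc.val x y z * D.tensorator z x y * D.assoc.val z x y = D.assoc.val x z y := by
  have h := D.hexagon_reverse x y z
  simp only [hbraid, hdeg, mul_one, one_mul] at h
  rw [← mul_inv, ← mul_inv, inv_inj] at h
  exact h

namespace Equivariant
variable (hdeg : ∀ x, D.deg x = x) (hbraid : ∀ x y, D.braid x y = 1)

/-- The half-braiding of an equivariant object. -/
def halfBraiding (X : Equivariant D) : HalfBraiding X.obj where
  β := halfBraidIso X
  monoidal U U' := by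
    refine GVec.hom_ext (lin_ext₃' fun x v hv y w hw z t ht => ?_)
    change halfBraidLin X (GVec.tensorObj U U') (v ⊗ₜ (w ⊗ₜ t)) =
      assocInv U U' X.obj (TensorProduct.map LinearMap.id (halfBraidLin X U')
        (assocHom U X.obj U' (TensorProduct.map (halfBraidLin X U) LinearMap.id
          (assocInv X.obj U U' (v ⊗ₜ (w ⊗ₜ t))))))
    rw [halfBraidLin_apply X (GVec.tensorObj U U') v (hw.tmul ht)]
    simp only [assocInv_apply hv hw ht, map_smul, TensorProduct.map_tmul,
      halfBraidLin_apply _ _ _ hw, LinearMap.id_apply, assocHom_apply hw (X.isHomog_act _ hv) ht,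
      halfBraidLin_apply _ _ _ ht, X.act_act _ _ hv, TensorProduct.tmul_smul,
      assocInv_apply hw ht (X.isHomog_act _ hv), smul_smul]
    -- The three associators in the hexagon and the compositor from `u y` followed by `u z` multiply
    -- to `1`.
    have e := D.compositor_eq hdeg hbraid x y z
    rw [← Units.val_mul, ← Units.val_mul, ← Units.val_mul, mul_assoc _ (D.assoc.val y x z),
      ← e, inv_mul_cancel_left, mul_inv_cancel,
      Units.val_one, one_smul]
  naturality {U U'} f := by
    refine GVec.hom_ext (lin_ext₂ fun x v hv y w hw => ?_)
    change halfBraidLin X U' (v ⊗ₜ lin f w) =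
      TensorProduct.map (lin f) LinearMap.id (halfBraidLin X U (v ⊗ₜ w))
    rw [halfBraidLin_apply _ _ _ hw, halfBraidLin_apply _ _ _ (hw.map f)]
    rfl

/-- The functor to the Drinfeld center. -/
def toCenter : Equivariant D ⥤ Center (GVec D.assoc) where
  obj X := ⟨X.obj, halfBraiding hdeg hbraid X⟩
  map {X Y} f := ⟨mor f, fun U => by
    refine GVec.hom_ext (lin_ext₂ fun x v hv y w hw => ?_)
    change halfBraidLin Y U (lin (mor f) v ⊗ₜ w) =
      TensorProduct.map LinearMap.id (lin (mor f)) (halfBraidLin X U (v ⊗ₜ w))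
    rw [halfBraidLin_apply _ _ _ hw, halfBraidLin_apply _ _ _ hw, TensorProduct.map_tmul, mor_act]
    rfl⟩
  map_id _ := rfl
  map_comp _ _ := rfl

instance : (toCenter hdeg hbraid).Additive where
  map_add := rfl

instance : (toCenter hdeg hbraid).Linear ℂ where
  map_smul _ _ := rfl

/-- The functor to the center preserves tensor products strictly. -/
def centerTensorIso (X Y : Equivariant D) : (toCenter hdeg hbraid).obj X ⊗
    (toCenter hdeg hbraid).obj Y ≅ (toCenter hdeg hbraid).obj (X ⊗ Y) :=
  haveI : IsIso (𝟙 (X.obj ⊗ Y.obj)) := inferInstance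
  @Center.isoMk _ _ _ ((toCenter hdeg hbraid).obj X ⊗ (toCenter hdeg hbraid).obj Y)
    ((toCenter hdeg hbraid).obj (X ⊗ Y)) ⟨𝟙 (X.obj ⊗ Y.obj), fun U => by
      refine GVec.hom_ext (lin_ext₃ (X := X.obj) (Y := Y.obj) fun x v hv y w hw z t ht => ?_)
      change halfBraidLin (Equivariant.tensorObj X Y) U ((v ⊗ₜ w) ⊗ₜ t) =
        TensorProduct.map LinearMap.id LinearMap.id (assocHom U X.obj Y.obj
          (TensorProduct.map (halfBraidLin X U) LinearMap.id (assocInv X.obj U Y.obj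
            (TensorProduct.map LinearMap.id (halfBraidLin Y U) (assocHom X.obj Y.obj U
              ((v ⊗ₜ w) ⊗ₜ t))))))
      have h : (Equivariant.tensorObj X Y).act z (v ⊗ₜ w) = _ := tensorAct_apply X Y z hv hw
      refine (halfBraidLin_apply (Equivariant.tensorObj X Y) U (v ⊗ₜ w) ht).trans ?_
      simp only [TensorProduct.map_id, LinearMap.id_apply, assocHom_apply hv hw ht, map_smul,
        TensorProduct.map_tmul, halfBraidLin_apply _ _ _ ht,
        assocInv_apply hv ht (Y.isHomog_act _ hw),
        assocHom_apply ht (X.isHomog_act _ hv) (Y.isHomog_act _ hw), smul_smul]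
      rw [h, TensorProduct.tmul_smul, ← Units.val_mul, ← Units.val_mul]
      congr 2
      -- The inverse tensorator in the equivariant tensor product is compared with the three
      -- associators in the half-braiding of a tensor product.
      have e := D.tensorator_eq hdeg hbraid x y z
      rw [← e]
      apply Additive.ofMul.injective
      simp only [ofMul_mul, ofMul_inv]
      abel⟩ this

/-- The functor to the center preserves the unit strictly. -/
def centerUnitIso : 𝟙_ (Center (GVec D.assoc)) ≅ (toCenter hdeg hbraid).obj (𝟙_ _) :=
  haveI : IsIso (𝟙 (𝟙_ (GVec D.assoc))) := inferInstance
  @Center.isoMk _ _ _ (𝟙_ (Center (GVec D.assoc)))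
    ((toCenter hdeg hbraid).obj (𝟙_ _)) ⟨𝟙 (𝟙_ (GVec D.assoc)), fun U => by
      refine GVec.hom_ext (lin_ext₂ (X := GVec.tensorUnit D.assoc) fun x v hv y w hw => ?_)
      refine (halfBraidLin_apply (Equivariant.tensorUnit D) U v hw).trans ?_
      change w ⊗ₜ v = TensorProduct.map LinearMap.id LinearMap.id (((show ℂ from v) • w) ⊗ₜ (1 : ℂ))
      rw [TensorProduct.map_id, LinearMap.id_apply, TensorProduct.smul_tmul, smul_eq_mul, mul_one]⟩
    this

/-- The functor to the center is monoidal. -/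
def centerCoreMonoidal : (toCenter hdeg hbraid).CoreMonoidal where
  εIso := centerUnitIso hdeg hbraid
  μIso := centerTensorIso hdeg hbraid
  μIso_hom_natural_left f X' :=
    Center.ext _ _ (GVec.hom_ext (TensorProduct.ext' fun v w => rfl))
  μIso_hom_natural_right X' f :=
    Center.ext _ _ (GVec.hom_ext (TensorProduct.ext' fun v w => rfl))
  associativity X Y Z := by
    refine Center.ext _ _ (GVec.hom_ext ?_)
    refine lin_ext₃ (X := X.obj) (Y := Y.obj) (Z := Z.obj) fun x v hv y w hw z t ht => ?_
    change assocHom X.obj Y.obj Z.obj ((v ⊗ₜ w) ⊗ₜ t) = TensorProduct.map LinearMap.id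
      LinearMap.id (assocHom X.obj Y.obj Z.obj ((v ⊗ₜ w) ⊗ₜ t))
    rw [TensorProduct.map_id, LinearMap.id_apply]
  left_unitality X :=
    Center.ext _ _ (GVec.hom_ext (TensorProduct.ext' fun c v => rfl))
  right_unitality X :=
    Center.ext _ _ (GVec.hom_ext (TensorProduct.ext' fun v c => rfl))

instance : (toCenter hdeg hbraid).Monoidal := (centerCoreMonoidal hdeg hbraid).toMonoidal

/-- The center braids by the half-braiding of the first factor, which moves it by the degree of the
second; with trivial crossed braiding and identity grading the equivariantisation does the same. -/
instance : (toCenter hdeg hbraid).Braided where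
  braided X Y := by
    refine Center.ext _ _ (GVec.hom_ext ?_)
    refine lin_ext₂ (X := X.obj) (Y := Y.obj) fun x v hv y w hw => ?_
    change braidLin X Y (v ⊗ₜ w) = halfBraidLin X Y.obj (v ⊗ₜ w)
    rw [braidLin_apply hv hw, halfBraidLin_apply _ _ _ hw, hdeg, hbraid, Units.val_one, one_smul]

end Equivariant
end Gauging

/-! ### From half-braidings back to equivariant objects -/

namespace Gauging
open GVec

namespace GVec
variable {S : Type} [AddCommGroup S] [Fintype S] [DecidableEq S] {ω : ThreeCocycle S}

/-- The simple object: `ℂ` in degree `y`. -/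
abbrev simple (ω : ThreeCocycle S) (y : S) : GVec ω where
  carrier := ℂ
  proj x := if x = y then LinearMap.id else 0
  proj_proj x z v := by
    by_cases h1 : x = y <;> by_cases h2 : z = y <;> by_cases h3 : x = z <;> simp_all
  sum_proj v := by
    have h : ∀ x : S, (if x = y then LinearMap.id else 0 : ℂ →ₗ[ℂ] ℂ) v = if x = y then v else 0 :=
      fun x => by split_ifs <;> rfl
    simp [h]

theorem isHomog_simple (y : S) (c : ℂ) : (simple ω y).IsHomog y c := by
  simp [IsHomog]

/-- The morphism from a simple object given by a homogeneous vector. -/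
def ofVector {U : GVec ω} {y : S} {w : U.carrier} (hw : U.IsHomog y w) : simple ω y ⟶ U :=
  ofLin (X := simple ω y) (LinearMap.toSpanSingleton ℂ U.carrier w) fun x c => by
    refine Eq.trans ?_ (map_smul (U.proj x) (show ℂ from c) w).symm
    rw [LinearMap.toSpanSingleton_apply, hw.proj]
    split_ifs with h <;> simp [h]

/-- Tensoring with the simple object of degree `y` shifts degrees by `y`, and the shift can be
cancelled. This extracts the degree of the `Z`-factor from total degrees. -/
theorem isHomog_of_one_tmul (Z : GVec ω) {y a : S} {v : Z.carrier}
    (hv : (tensorObj (simple ω y) Z).IsHomog (a + y) ((1 : ℂ) ⊗ₜ v)) : Z.IsHomog a v := by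
  have h : TensorProduct.lid ℂ Z.carrier ((tensorObj (simple ω y) Z).proj (a + y) ((1 : ℂ) ⊗ₜ v)) =
      Z.proj a v := by
    have h' : (TensorProduct.lid ℂ Z.carrier).toLinearMap ∘ₗ
        (tensorObj (simple ω y) Z).proj (a + y) ∘ₗ TensorProduct.mk ℂ ℂ Z.carrier 1 = Z.proj a := by
      refine lin_ext fun x w hw => ?_
      change TensorProduct.lid ℂ Z.carrier ((tensorObj (simple ω y) Z).proj _ _) = _
      have e := ((isHomog_simple (ω := ω) y 1).tmul hw).proj (a + y)
      refine (congrArg _ e).trans ?_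
      rw [hw.proj, add_comm a y]
      by_cases hx : a = x
      · subst hx; simp
      · simp [hx]
    exact LinearMap.congr_fun h' v
  rw [IsHomog, ← h, show (tensorObj (simple ω y) Z).proj (a + y) ((1 : ℂ) ⊗ₜ v) = _ from hv]
  simp

section HalfBraiding
variable {Z : GVec ω} (b : HalfBraiding Z)

/-- The action on `Z` defined by the half-braiding with the simple object of degree `y`. -/
def braidEquiv (y : S) : Z.carrier ≃ₗ[ℂ] Z.carrier :=
  (TensorProduct.rid ℂ Z.carrier).symm ≪≫ₗ
    LinearEquiv.ofLinearMap (lin (b.β (simple ω y)).hom) (lin (b.β (simple ω y)).inv)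
      (congrArg lin (b.β (simple ω y)).inv_hom_id :) (congrArg lin (b.β (simple ω y)).hom_inv_id :)
    ≪≫ₗ TensorProduct.lid ℂ Z.carrier

theorem one_tmul_braidEquiv (y : S) (v : Z.carrier) :
    lin (b.β (simple ω y)).hom (v ⊗ₜ (1 : ℂ)) = (1 : ℂ) ⊗ₜ braidEquiv b y v := by
  apply (TensorProduct.lid ℂ Z.carrier).injective
  rw [TensorProduct.lid_tmul, one_smul]
  rfl

/-- A homogeneous vector is a morphism from a simple object, so naturality along that morphism
determines the half-braiding by its values on simple objects. -/
theorem braid_apply {U : GVec ω} {y : S} {w : U.carrier} (hw : U.IsHomog y w) (v : Z.carrier) :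
    lin (b.β U).hom (v ⊗ₜ w) = w ⊗ₜ braidEquiv b y v := by
  have h := LinearMap.congr_fun (congrArg lin (b.naturality (ofVector hw))) (v ⊗ₜ (1 : ℂ))
  have e : lin (ofVector hw) (1 : ℂ) = w := one_smul ℂ w
  change lin (b.β U).hom (v ⊗ₜ lin (ofVector hw) (1 : ℂ)) =
    TensorProduct.map (lin (ofVector hw)) LinearMap.id
      (lin (b.β (simple ω y)).hom (v ⊗ₜ (1 : ℂ))) at h
  rw [one_tmul_braidEquiv, TensorProduct.map_tmul] at h
  rw [e] at h
  exact h

theorem isHomog_braidEquiv (y : S) {x : S} {v : Z.carrier} (hv : Z.IsHomog x v) :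
    Z.IsHomog x (braidEquiv b y v) := by
  apply isHomog_of_one_tmul Z (y := y)
  rw [← one_tmul_braidEquiv]
  exact IsHomog.map (b.β (simple ω y)).hom (hv.tmul (isHomog_simple y 1))

/-- The hexagon of the half-braiding at the simple objects of degrees `h` and `g`. It will become
the composition law of an equivariant object through `CrossedData.compositor_eq`. -/
theorem braidEquiv_braidEquiv (g h : S) {x : S} {v : Z.carrier} (hv : Z.IsHomog x v) :
    ((ω.val h x g : ℂˣ) : ℂ) • braidEquiv b g (braidEquiv b h v) =
      ((ω.val x h g * ω.val h g x : ℂˣ) : ℂ) • braidEquiv b (h + g) v := by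
  have key := LinearMap.congr_fun (congrArg lin (b.monoidal (simple ω h) (simple ω g)))
    (v ⊗ₜ ((1 : ℂ) ⊗ₜ (1 : ℂ)))
  have h1 := isHomog_simple (ω := ω) h 1
  have h2 := isHomog_simple (ω := ω) g 1
  change lin (b.β (tensorObj (simple ω h) (simple ω g))).hom (v ⊗ₜ ((1 : ℂ) ⊗ₜ (1 : ℂ))) =
      assocInv (simple ω h) (simple ω g) Z (TensorProduct.map LinearMap.id
        (lin (b.β (simple ω g)).hom) (assocHom (simple ω h) Z (simple ω g)
          (TensorProduct.map (lin (b.β (simple ω h)).hom) LinearMap.id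
          (assocInv Z (simple ω h) (simple ω g) (v ⊗ₜ ((1 : ℂ) ⊗ₜ (1 : ℂ))))))) at key
  -- The vector `1 ⊗ 1` has degree `h + g`, so the left side is known without identifying the tensor
  -- product of the two simple objects with a third one.
  have e := braid_apply b (h1.tmul h2) v
  have key' := e.symm.trans key
  simp only [assocInv_apply hv h1 h2, map_smul, TensorProduct.map_tmul,
    braid_apply b h1, LinearMap.id_apply,
    assocHom_apply h1 (isHomog_braidEquiv b h hv) h2,
    braid_apply b h2,
    assocInv_apply h1 h2 (isHomog_braidEquiv b g (isHomog_braidEquiv b h hv)), smul_smul] at key'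
  -- Collapsing the one-dimensional factors turns the identity of tensors into one of vectors in
  -- `Z`.
  have key'' := congrArg (TensorProduct.lid ℂ Z.carrier)
    (congrArg (TensorProduct.map (TensorProduct.lid ℂ ℂ).toLinearMap LinearMap.id) key')
  simp only [map_smul, TensorProduct.map_tmul, LinearEquiv.coe_coe, TensorProduct.lid_tmul,
    LinearMap.id_apply, one_smul] at key''
  rw [key'', smul_smul]
  congr 1
  rw [← Units.val_mul, ← Units.val_mul, ← Units.val_mul]
  congr 1
  apply Additive.ofMul.injective
  simp only [ofMul_mul, ofMul_inv]
  abel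

end HalfBraiding
end GVec

namespace Equivariant
variable {G : Type} [AddCommGroup G] [Fintype G] [DecidableEq G] {D : CrossedData G G}
variable (hdeg : ∀ x, D.deg x = x) (hbraid : ∀ x y, D.braid x y = 1)

/-- The equivariant object defined by an object of the center. -/
def ofHalfBraiding {Z : GVec D.assoc} (b : HalfBraiding Z) : Equivariant D where
  obj := Z
  u g := isoOfEquiv (braidEquiv b g)
    (comm_of_isHomog (braidEquiv b g).toLinearMap fun _ _ hv => isHomog_braidEquiv b g hv)
  u_comp g h := by
    refine GVec.hom_ext (lin_ext fun x v hv => ?_)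
    change braidEquiv b g (braidEquiv b h v) = braidEquiv b (h + g) (scalar₁ Z _ v)
    rw [scalar₁_apply _ _ hv, map_smul]
    have e := braidEquiv_braidEquiv b g h hv
    -- Both sides now carry the factor `ω(h, x, g)`; cancelling it leaves the compositor.
    rw [D.compositor_eq hdeg hbraid x h g, Units.val_mul, mul_smul] at e
    exact smul_right_injective _ (Units.ne_zero _) e

instance : (toCenter hdeg hbraid).Faithful where
  map_injective h := Equivariant.hom_ext (congrArg (fun f => Center.Hom.f f) h :)

/-- Compatibility with the half-braidings, tested on `v ⊗ 1` with the simple object of degree `g`,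
is compatibility with `u g`. -/
instance : (toCenter hdeg hbraid).Full where
  map_surjective {X Y} f := by
    let φ : X.obj ⟶ Y.obj := f.f
    refine ⟨ofMor φ fun g => ?_, rfl⟩
    refine GVec.hom_ext (LinearMap.ext fun v => ?_)
    have h := LinearMap.congr_fun (congrArg lin (f.comm (simple D.assoc g)))
      (show X.obj.carrier ⊗[ℂ] ℂ from v ⊗ₜ (1 : ℂ))
    have h1 := isHomog_simple (ω := D.assoc) g 1
    change halfBraidLin Y (simple D.assoc g) (lin φ v ⊗ₜ (1 : ℂ)) =
      TensorProduct.map LinearMap.id (lin φ) (halfBraidLin X (simple D.assoc g) (v ⊗ₜ (1 : ℂ))) at h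
    rw [halfBraidLin_apply _ _ _ h1, halfBraidLin_apply _ _ _ h1, TensorProduct.map_tmul] at h
    have h' := congrArg (TensorProduct.lid ℂ Y.obj.carrier) h
    rw [TensorProduct.lid_tmul, TensorProduct.lid_tmul, one_smul, LinearMap.id_apply,
      one_smul] at h'
    exact h'.symm

/-- The half-braiding rebuilt from the simple objects agrees with the given one on every graded
vector space by `braid_apply`, so the identity is an isomorphism in the center. -/
instance : (toCenter hdeg hbraid).EssSurj where
  mem_essImage W := by
    have : IsIso (𝟙 W.1) := inferInstance
    refine ⟨ofHalfBraiding hdeg hbraid W.2, ⟨@Center.isoMk _ _ _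
      ((toCenter hdeg hbraid).obj (ofHalfBraiding hdeg hbraid W.2)) W ⟨𝟙 W.1, fun U => ?_⟩ this⟩⟩
    refine GVec.hom_ext (lin_ext₂ fun x v hv y w hw => ?_)
    change lin (W.2.β U).hom (v ⊗ₜ w) = TensorProduct.map LinearMap.id LinearMap.id
      (halfBraidLin (ofHalfBraiding hdeg hbraid W.2) U (v ⊗ₜ w))
    rw [TensorProduct.map_id, LinearMap.id_apply]
    refine (braid_apply W.2 hw v).trans ?_
    exact (halfBraidLin_apply (ofHalfBraiding hdeg hbraid W.2) U v hw).symm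

/-- The equivariantisation of a crossed braided category with simple objects `G`, graded by
themselves, is the Drinfeld center. -/
theorem braidedEquivalent_center (hdeg : ∀ x, D.deg x = x)
    (hbraid : ∀ x y, D.braid x y = 1) : BraidedEquivalent (Equivariant D) (TwistedDouble D.assoc) :=
  ⟨toCenter hdeg hbraid, { }, inferInstance, inferInstance, ⟨inferInstance⟩⟩

end Equivariant
end Gauging

/-! ### Composition, transport along group isomorphisms, and the twisted double -/

namespace Gauging

theorem BraidedEquivalent.trans {C D E : Type*} [Category C] [Preadditive C] [Linear ℂ C]
    [MonoidalCategory C] [BraidedCategory C] [Category D] [Preadditive D] [Linear ℂ D]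
    [MonoidalCategory D] [BraidedCategory D] [Category E] [Preadditive E] [Linear ℂ E]
    [MonoidalCategory E] [BraidedCategory E] (h : BraidedEquivalent C D)
    (h' : BraidedEquivalent D E) : BraidedEquivalent C E := by
  obtain ⟨F, _, _, _, ⟨_⟩⟩ := h
  obtain ⟨F', _, _, _, ⟨_⟩⟩ := h'
  exact ⟨F ⋙ F', inferInstance, inferInstance, inferInstance, ⟨inferInstance⟩⟩

/-- The restriction of a pointed crossed braided category along a homomorphism to its group of simple
objects. -/
def CrossedData.pullback {G S S' : Type} [AddCommGroup G] [AddCommGroup S] [AddCommGroup S']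
    (D : CrossedData G S) (e : S' →+ S) : CrossedData G S' where
  deg := D.deg.comp e
  assoc :=
    { val := fun x y z => D.assoc.val (e x) (e y) (e z)
      val_zero := fun x z => by simpa using D.assoc.val_zero (e x) (e z)
      pentagon := fun x y z w => by simpa using D.assoc.pentagon (e x) (e y) (e z) (e w) }
  tensorator g x y := D.tensorator g (e x) (e y)
  compositor g h x := D.compositor g h (e x)
  braid x y := D.braid (e x) (e y)
  tensorator_assoc g x y z := by simpa using D.tensorator_assoc g (e x) (e y) (e z)
  tensorator_zero_left g y := by simpa using D.tensorator_zero_left g (e y)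
  tensorator_zero_right g x := by simpa using D.tensorator_zero_right g (e x)
  tensorator_id x y := D.tensorator_id (e x) (e y)
  compositor_id_left h x := D.compositor_id_left h (e x)
  compositor_id_right g x := D.compositor_id_right g (e x)
  compositor_zero g h := by simpa using D.compositor_zero g h
  compositor_assoc f g h x := D.compositor_assoc f g h (e x)
  compositor_tensor g h x y := by simpa using D.compositor_tensor g h (e x) (e y)
  braid_equivariant g x y := D.braid_equivariant g (e x) (e y)
  hexagon_forward x y z := by simpa using D.hexagon_forward (e x) (e y) (e z)
  hexagon_reverse x y z := by simpa using D.hexagon_reverse (e x) (e y) (e z)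

/-- A regrading with trivial kernel and trivial `char`. It serves to replace the group of simple
objects of a zesting with trivial fractionalisation by `G` itself, as the comparison with the center
requires. -/
theorem braidedEquivalent_pullback {G S S' : Type} [AddCommGroup G] [AddCommGroup S]
    [AddCommGroup S'] [Fintype S] [DecidableEq S] [Fintype S'] [DecidableEq S']
    (D : CrossedData G S) (e : S' ≃+ S) :
    BraidedEquivalent (Equivariant D) (Equivariant (D.pullback e.toAddMonoidHom)) :=
  let R : Regrading D (D.pullback e.toAddMonoidHom) :=
    { obj := e.symm.toAddMonoidHom
      grp := AddMonoidHom.id G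
      char := 1
      char_add := by simp
      deg := by simp [CrossedData.pullback]
      assoc := by simp [CrossedData.pullback]
      tensorator := by simp [CrossedData.pullback]
      compositor := by simp [CrossedData.pullback]
      braid := by simp [CrossedData.pullback] }
  Regrading.Separation.braidedEquivalent (R := R) (K := Unit)
    { incl := 0
      grp_incl := fun _ => map_zero _
      exact := fun a b h => ⟨0, by simpa [R] using h⟩
      surjective := fun a => ⟨a, rfl⟩
      sum_char := fun x y h h' => absurd (e.symm.injective h) h'
      sum_fibre := fun s k => by simp [R, AddEquiv.symm_apply_eq] }

section
variable {G : Type} [AddCommGroup G]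

/-- The simple objects of the zesting of `G-Vect` by `ω`. -/
def zestedEquiv (ω : ThreeCocycle G) :
    G ≃+ Zested (ZestingDatum.ofCocycle (groupExtension G) ω) where
  toFun := Zested.of _
  invFun := Zested.un _
  map_add' x y := Zested.un_inj _ (by
    rw [Zested.un_add]
    exact (add_zero _).symm)

/-- Gauging the `G`-symmetry of `G-Vect^ω` yields the twisted double. -/
theorem twistedGauging_equivalent_twistedDouble [Fintype G] [DecidableEq G] (ω : ThreeCocycle G) :
    BraidedEquivalent (TwistedGauging ω) (TwistedDouble ω) := by
  have h := braidedEquivalent_pullback (zest (groupExtension G) (.ofCocycle _ ω)) (zestedEquiv ω)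
  -- The zested associator is `ω` times a braiding scalar of `groupExtension`, which is `1`;
  -- equality of the cocycles themselves makes the center in `h'` the one over `ω`.
  have hω : ((zest (groupExtension G) (.ofCocycle _ ω)).pullback
      (zestedEquiv ω).toAddMonoidHom).assoc = ω := by
    obtain ⟨val, _, _⟩ := ω
    simp only [CrossedData.pullback, ThreeCocycle.mk.injEq]
    funext x y z
    exact mul_one _
  have h' := Equivariant.braidedEquivalent_center (G := G)
    (D := (zest (groupExtension G) (.ofCocycle _ ω)).pullback (zestedEquiv ω).toAddMonoidHom)
    (fun _ => rfl) (fun _ _ => rfl)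
  rw [hω] at h'
  exact h.trans h'
end

/-! ### The ungauged case: the double of `ℤ/2` -/

section
open Zested

/-- A vector of degree `m^a e^b` gets the degree `a`, and the generator of the group acts
by `(-1)^b`. -/
def doubleZ2Regrading : Regrading
    (zest (braidedVec doubleZ2Braiding) (.ofCocycle _ (.trivial Unit)))
    (zest (groupExtension (ZMod 2)) (.ofCocycle _ (.trivial (ZMod 2)))) where
  obj :=
    { toFun := fun x => of _ (un _ x).1
      map_zero' := rfl
      map_add' := fun x y => rfl }
  grp := 0
  char k x := (-1) ^ (k.val * (un _ x).2.val)
  char_add k x y := by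
    rw [← pow_add]
    apply neg_one_pow_congr
    have h : un _ (x + y) = un _ x + un _ y := add_zero _
    rw [h]
    push_cast [val_add_two, Prod.snd_add]
    ring
  deg _ := rfl
  assoc x y z := by
    refine Eq.trans (one_mul 1) ?_
    exact ((one_mul _).trans (ZestingDatum.braid_zero_left _ _)).symm
  tensorator _ _ _ := rfl
  compositor g h x := by
    -- With no fractionalisation the charge `b` gives an honest character of `ℤ/2`, so no multiplier
    -- arises.
    have e : (-1 : ℂˣ) ^ ((h + g).val * (un _ x).2.val) =
        (-1) ^ (g.val * (un _ x).2.val) * (-1) ^ (h.val * (un _ x).2.val) := by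
      rw [← pow_add]
      apply neg_one_pow_congr
      push_cast [val_add_two]
      ring
    rw [e]
    congr 1
    simp [zest, ZestingDatum.ofCocycle, groupExtension, ThreeCocycle.trivial,
      ZestingDatum.braid_zero_left, ZestingDatum.braid_zero_right]
  -- The whole braiding `(-1)^(b a')` is the action of the degree `a'` on the charge `b`.
  braid x y := (one_mul _).trans (congrArg _ (mul_comm _ _))

end

/-! ### The gauged case: `ℤ/4` by carrying -/

section
open Zested

/-- The reduction modulo `2`. -/
def reduction : ZMod 4 →+ ZMod 2 := (ZMod.castHom (by decide : 2 ∣ 4) (ZMod 2)).toAddMonoidHom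

/-- The degree in `ℤ/4` of the simple object `m^a e^b` of degree `g`. -/
def degreeFour (x : ZMod 2 × (ZMod 2 × ZMod 2)) : ZMod 4 := x.1.val + 2 * x.2.1.val

theorem reduction_degreeFour (x : ZMod 2 × (ZMod 2 × ZMod 2)) :
    reduction (degreeFour x) = x.1 := by
  revert x; unfold degreeFour reduction; decide

/-- The braiding sees only the `e`-exponent of its left argument, and the fractionalisation is a
power of `m`. Hence the associator reduces to `ν`, and only the braiding of `x` with `m` remains in
the compositor. -/
theorem braid_frac_left (p : ℤˣ) (g h : ZMod 2) (x : ZMod 2 × (ZMod 2 × ZMod 2)) :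
    (trivialExtension (ZMod 2) doubleZ2Braiding).braid ((doubleZ2Zesting p).frac g h) x = 1 := by
  simp only [doubleZ2Zesting, trivialExtension, doubleZ2Braiding]
  split_ifs <;> simp

/-- A vector of degree `m^a e^b` gets the degree `g + 2 a`, and the action of the class of `k` is
multiplied by `(-1)^b` if `k = 2` or `k = 3`. -/
def gaugedRegrading (p : ℤˣ) (ω : ThreeCocycle (ZMod 4)) (hω : ∀ k l n, ω.val k l n =
    (doubleZ2Zesting p).assoc (reduction k) (reduction l) (reduction n)) : Regrading
    (zest (trivialExtension (ZMod 2) doubleZ2Braiding) (doubleZ2Zesting p))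
    (zest (groupExtension (ZMod 4)) (.ofCocycle _ ω)) where
  obj :=
    { toFun := fun x => of _ (degreeFour (un _ x))
      map_zero' := rfl
      map_add' := fun x y => un_inj _ (by
        -- The extra `m` for two odd degrees is the carry from the lower binary digit `g` to the
        -- upper digit `a`.
        have h : ∀ x y : ZMod 2 × (ZMod 2 × ZMod 2), degreeFour (x + y +
          (if x.1 = 1 ∧ y.1 = 1 then (0, (1, 0)) else 0)) = degreeFour x + degreeFour y + 0 := by
          unfold degreeFour; decide
        exact h (un _ x) (un _ y)) }
  grp := reduction
  char k x := (-1) ^ (k.val / 2 * (un _ x).2.2.val)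
  char_add k x y := by
    rw [← pow_add]
    apply neg_one_pow_congr
    -- The extra factor `m` carries no `e`-charge, so charges add as before zesting.
    have h : ∀ x y : ZMod 2 × (ZMod 2 × ZMod 2), (x + y +
          (if x.1 = 1 ∧ y.1 = 1 then (0, (1, 0)) else 0)).2.2 = x.2.2 + y.2.2 := by
      decide
    have h' : (un _ (x + y)).2.2 = (un _ x).2.2 + (un _ y).2.2 := h _ _
    rw [h']
    push_cast [val_add_two]
    ring
  deg x := reduction_degreeFour (un _ x)
  assoc x y z := by
    change ω.val (degreeFour (un _ x)) (degreeFour (un _ y)) (degreeFour (un _ z)) * 1 =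
      (doubleZ2Zesting p).assoc (un _ x).1 (un _ y).1 (un _ z).1 *
        (trivialExtension (ZMod 2) doubleZ2Braiding).braid ((doubleZ2Zesting p).frac _ _) (un _ z)
    rw [hω, reduction_degreeFour, reduction_degreeFour, reduction_degreeFour, braid_frac_left]
  tensorator g x y := by
    change (ω.val (degreeFour (un _ x)) (degreeFour (un _ y)) g)⁻¹ *
        ω.val (degreeFour (un _ x)) g (degreeFour (un _ y)) *
        (ω.val g (degreeFour (un _ x)) (degreeFour (un _ y)))⁻¹ = _
    rw [hω, hω, hω, reduction_degreeFour, reduction_degreeFour]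
    rfl
  compositor g h x := by
    -- Modulo `2`, the upper binary digit of a sum is the sum of the upper digits plus the carry,
    -- and the carry is the `m`-exponent of the fractionalisation. So `char` fails to be
    -- multiplicative in the group variable exactly by the braiding with `m`.
    have hg : ∀ g h : ZMod 4, (((h + g).val / 2 : ℕ) : ZMod 2) =
        (if reduction h = 1 ∧ reduction g = 1 then ((0, (1, 0)) : ZMod 2 × (ZMod 2 × ZMod 2))
          else 0).2.1.val + (g.val / 2 : ℕ) + (h.val / 2 : ℕ) := by
      unfold reduction; decide
    have e : (-1 : ℂˣ) ^ ((h + g).val / 2 * (un _ x).2.2.val) =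
        (trivialExtension (ZMod 2) doubleZ2Braiding).braid (un _ x)
          ((doubleZ2Zesting p).frac (reduction h) (reduction g)) *
        ((-1) ^ (g.val / 2 * (un _ x).2.2.val) * (-1) ^ (h.val / 2 * (un _ x).2.2.val)) := by
      change _ = (-1 : ℂˣ) ^ _ * _
      rw [← pow_add, ← pow_add]
      apply neg_one_pow_congr
      push_cast [hg]
      simp only [doubleZ2Zesting]
      ring
    change ω.val (degreeFour (un _ x)) h g * (ω.val h (degreeFour (un _ x)) g)⁻¹ *
        ω.val h g (degreeFour (un _ x)) * (1 * 1) * (-1) ^ ((h + g).val / 2 * (un _ x).2.2.val) =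
      (doubleZ2Zesting p).assoc (un _ x).1 (reduction h) (reduction g) *
        ((doubleZ2Zesting p).assoc (reduction h) (un _ x).1 (reduction g))⁻¹ *
        (doubleZ2Zesting p).assoc (reduction h) (reduction g) (un _ x).1 *
        ((trivialExtension (ZMod 2) doubleZ2Braiding).braid
          ((doubleZ2Zesting p).frac (reduction h) (reduction g)) (un _ x) *
        (trivialExtension (ZMod 2) doubleZ2Braiding).braid (un _ x)
          ((doubleZ2Zesting p).frac (reduction h) (reduction g))) * _
    rw [e, hω, hω, hω, reduction_degreeFour, braid_frac_left, one_mul, one_mul, mul_one,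
      mul_assoc _ (StrictCrossed.braid _ _ _)]
  braid x y := by
    -- The upper digit of the coarse degree is the `m`-exponent, so `char` at that degree reproduces
    -- the original braiding.
    have h : ∀ y : ZMod 2 × (ZMod 2 × ZMod 2), (degreeFour y).val / 2 = y.2.1.val := by
      unfold degreeFour; decide
    refine (one_mul _).trans ?_
    change (-1 : ℂˣ) ^ ((degreeFour (un _ y)).val / 2 * _) = (-1) ^ _
    rw [h, mul_comm]
end

/-! ### Orthogonality of the signs and separation of the `e`-charges -/

theorem sum_sign {b c : ZMod 2} (h : b ≠ c) : ∑ k : ZMod 2,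
    (((-1) ^ (k.val * b.val) : ℂˣ) : ℂ)⁻¹ * (((-1) ^ (k.val * c.val) : ℂˣ) : ℂ) = 0 := by
  have h' : (b = 0 ∧ c = 1) ∨ (b = 1 ∧ c = 0) := by
    revert b c; decide
  have e : ∀ f : ZMod 2 → ℂ, ∑ k, f k = f 0 + f 1 := Fin.sum_univ_two
  rw [e]
  rcases h' with ⟨rfl, rfl⟩ | ⟨rfl, rfl⟩ <;> simp [ZMod.val_one]

theorem sum_sign_inv (k : ZMod 2) : ∑ b : ZMod 2, (((-1) ^ (k.val * b.val) : ℂˣ) : ℂ)⁻¹ =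
    if k = 0 then (Fintype.card (ZMod 2) : ℂ) else 0 := by
  have h' : k = 0 ∨ k = 1 := by
    revert k; decide
  have e : ∀ f : ZMod 2 → ℂ, ∑ k, f k = f 0 + f 1 := Fin.sum_univ_two
  rw [e]
  rcases h' with rfl | rfl <;> simp [ZMod.val_one, one_add_one_eq_two]

/-- The separation of the degrees `m^a e^0` and `m^a e^1` by the action of the generator. -/
def doubleZ2Separation : doubleZ2Regrading.Separation (ZMod 2) where
  incl := AddMonoidHom.id _
  grp_incl _ := rfl
  exact a b _ := ⟨a - b, (sub_add_cancel a b).symm⟩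
  surjective _ := ⟨0, rfl⟩
  sum_char := by
    rintro ⟨a, b⟩ ⟨a', b'⟩ (rfl : a = a') h'
    have hb : b ≠ b' := fun hb => h' (by rw [hb])
    exact sum_sign hb
  sum_fibre s k := by
    -- The fibre over `s` consists of `m^s` and `m^s e`, so it is parametrised by the charge, and
    -- the sum runs over all characters of `ℤ/2`.
    have h : ∀ s : ZMod 2, (∑ x : ZMod 2 × ZMod 2, if x.1 = s then
        (((-1) ^ (k.val * x.2.val) : ℂˣ) : ℂ)⁻¹ else 0) =
        if k = 0 then (Fintype.card (ZMod 2) : ℂ) else 0 := fun s => by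
      rw [← sum_sign_inv k, Fintype.sum_prod_type_right]
      exact Finset.sum_congr rfl fun b _ => by simp
    exact h s

/-- The inclusion of `ℤ/2` in `ℤ/4`. -/
def doubling : ZMod 2 →+ ZMod 4 where
  toFun k := 2 * (k.val : ZMod 4)
  map_zero' := rfl
  map_add' := by decide

theorem char_gaugedRegrading (p : ℤˣ) (ω : ThreeCocycle (ZMod 4)) (hω : ∀ k l n, ω.val k l n =
    (doubleZ2Zesting p).assoc (reduction k) (reduction l) (reduction n)) (k : ZMod 2)
    (x : Zested (doubleZ2Zesting p)) :
    (gaugedRegrading p ω hω).char (doubling k) x =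
      (-1) ^ (k.val * (Zested.un _ x).2.2.val) := by
  have h : ∀ k : ZMod 2, (2 * (k.val : ZMod 4)).val / 2 = k.val := by decide
  change (-1 : ℂˣ) ^ ((2 * (k.val : ZMod 4)).val / 2 * _) = _
  rw [h]

/-- The separation of the degrees `m^a e^0` and `m^a e^1` by the action of `2`. -/
def gaugedSeparation (p : ℤˣ) (ω : ThreeCocycle (ZMod 4)) (hω : ∀ k l n, ω.val k l n =
    (doubleZ2Zesting p).assoc (reduction k) (reduction l) (reduction n)) :
    (gaugedRegrading p ω hω).Separation (ZMod 2) where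
  incl := doubling
  grp_incl := by
    change ∀ k : ZMod 2, reduction (2 * (k.val : ZMod 4)) = 0
    unfold reduction; decide
  exact := by
    change ∀ a b : ZMod 4, reduction a = reduction b → ∃ k : ZMod 2, a = 2 * (k.val : ZMod 4) + b
    unfold reduction; decide
  surjective := by
    change ∀ b : ZMod 2, ∃ a : ZMod 4, reduction a = b
    unfold reduction; decide
  sum_char x y h h' := by
    have hb : ∀ x y : ZMod 2 × (ZMod 2 × ZMod 2), degreeFour x = degreeFour y → x ≠ y →
        x.2.2 ≠ y.2.2 := by
      unfold degreeFour; decide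
    refine Eq.trans (Finset.sum_congr rfl fun k _ => ?_) (sum_sign (hb _ _ h h'))
    rw [char_gaugedRegrading, char_gaugedRegrading]
  sum_fibre s k := by
    -- The two binary digits of `s` fix `g` and `a`; only the charge `b` varies in the fibre.
    have hs : ∀ s : ZMod 4, ∃ g a : ZMod 2, ∀ x : ZMod 2 × (ZMod 2 × ZMod 2),
        degreeFour x = s ↔ x.1 = g ∧ x.2.1 = a := by
      unfold degreeFour; decide
    obtain ⟨g, a, h⟩ := hs s
    refine Eq.trans (b := ∑ x : ZMod 2 × (ZMod 2 × ZMod 2), if x.1 = g ∧ x.2.1 = a then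
      (((-1) ^ (k.val * x.2.2.val) : ℂˣ) : ℂ)⁻¹ else 0)
      (Finset.sum_congr rfl fun x _ => if_congr (h x) ?_ rfl) ?_
    · exact congrArg _ (congrArg _ (char_gaugedRegrading p ω hω k x))
    · rw [← sum_sign_inv k]
      simp [Fintype.sum_prod_type, ite_and]

theorem trivial_val (k l n : ZMod 4) : (ThreeCocycle.trivial (ZMod 4)).val k l n =
    (doubleZ2Zesting 1).assoc (reduction k) (reduction l) (reduction n) := by
  simp [ThreeCocycle.trivial, doubleZ2Zesting]

/-- A product of three integers is odd exactly when all three are, so the sign depends only on the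
reductions and is `-1` only at `(1, 1, 1)`. -/
theorem signCocycle_val (k l n : ZMod 4) : signCocycle.val k l n =
    (doubleZ2Zesting (-1)).assoc (reduction k) (reduction l) (reduction n) := by
  have h : ∀ k l n : ZMod 4, reduction k = 1 ∧ reduction l = 1 ∧ reduction n = 1 ↔
    Odd (k.val * l.val * n.val) := by
    unfold reduction; decide
  simp only [signCocycle, doubleZ2Zesting, h]
  split_ifs with hk
  · rw [hk.neg_one_pow]
    ext
    simp
  · rw [(Nat.not_odd_iff_even.mp hk).neg_one_pow]

end Gauging

end

theorem mainTheorem3 :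
    Gauging.BraidedEquivalent
        (Gauging.StrictEquivariant (Gauging.braidedVec Gauging.doubleZ2Braiding))
        (Gauging.TwistedDouble (Gauging.ThreeCocycle.trivial (ZMod 2))) ∧
    Gauging.BraidedEquivalent (Gauging.GaugedDoubleZ2 1)
        (Gauging.TwistedDouble (Gauging.ThreeCocycle.trivial (ZMod 4))) ∧
    Gauging.BraidedEquivalent (Gauging.GaugedDoubleZ2 (-1))
        (Gauging.TwistedDouble Gauging.signCocycle) ∧
    Gauging.BraidedEquivalent (Gauging.GaugedDoubleZ2 (-1))
        (Gauging.TwistedGauging Gauging.signCocycle) := by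
  -- This is already the comparison with the equivariantisation of `ℤ/4-Vect` twisted by the sign
  -- cocycle; composing it with the passage to the center gives the statement about the double.
  have h := (Gauging.gaugedSeparation (-1) _ Gauging.signCocycle_val).braidedEquivalent
  exact ⟨Gauging.doubleZ2Separation.braidedEquivalent.trans
      (Gauging.twistedGauging_equivalent_twistedDouble _),
    (Gauging.gaugedSeparation 1 _ Gauging.trivial_val).braidedEquivalent.trans
      (Gauging.twistedGauging_equivalent_twistedDouble _),
    h.trans (Gauging.twistedGauging_equivalent_twistedDouble _), h⟩
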